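/- **Theorem 7.5.1.** For all positive integers $k\le n$ there is an $\mathsf{LAQCC}$-$\mathsf{LOG}$ circuit on $\mathrm{poly}(n)$ qubits that prepares the Dicke-$(n,k)$ state $$|D^n_k\rangle=\binom{n}{k}^{-1/2}\sum_{x\in\{0,1\}^n,\ |x|=k}|x\rangle .$$ Here $\mathsf{LAQCC}$-$\mathsf{LOG}=\mathsf{LAQCC}(\mathsf{QNC}^0,\mathsf{NC}^1,O(\log n))$: the qubits form a rectangular grid and start in $|0\cdots0\rangle$, and the circuit consists of $O(\log n)$ alternations. Each alternation consists of (i) a conventional Boolean circuit of bounded fan-in (AND, OR, NOT), of depth $O(\log n)$ and size $\mathrm{poly}(n)$, whose input consists of the earlier measurement outcomes; (ii) a quantum circuit of depth $O(1)$ of arbitrary single-qubit gates and CNOT gates between neighboring qubits of the grid, where each gate may be controlled by an output bit of the conventional circuit; (iii) a measurement of a subset of the qubits in the computational basis. The preparation is exact and deterministic: for all measurement outcomes that occur, the final state is, up to a global phase, $|D^n_k\rangle$ on $n$ fixed output qubits with all other qubits in $|0\rangle$. The implied constants and polynomials do not depend on $n$ and $k$. -/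

import Mathlib

/-! ### Conventional (Boolean) circuits of bounded fan-in -/

/-- A gate of fan-in at most two, reading wires labelled by `In`. -/
inductive BoolGate (In : Type) : Type
  | const (b : Bool) : BoolGate In
  | wire (a : In) : BoolGate In
  | not (a : In) : BoolGate In
  | and (a b : In) : BoolGate In
  | or (a b : In) : BoolGate In

namespace BoolGate

def eval {In : Type} (v : In → Bool) : BoolGate In → Bool
  | const b => b
  | wire a => v a
  | not a => !(v a)
  | and a b => v a && v b
  | or a b => v a || v b

end BoolGate

/-- A layered circuit with input wires `In` and output wires `Out`. A layer is a finite family of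
gates, each of which reads wires of the preceding layer (with unrestricted fan-out); `wire` gates
carry values along. At the end the outputs are read off the wires of the last layer. -/
inductive BoolCircuit : Type → Type → Type 1
  | output {In Out : Type} (f : Out → In) : BoolCircuit In Out
  | layer {In Mid Out : Type} [Fintype Mid] (g : Mid → BoolGate In)
      (rest : BoolCircuit Mid Out) : BoolCircuit In Out

namespace BoolCircuit

def eval : {In Out : Type} → BoolCircuit In Out → (In → Bool) → (Out → Bool)
  | _, _, output f, v => fun o => v (f o)
  | _, _, layer g rest, v => rest.eval (fun m => (g m).eval v)

/-- The number of layers. -/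
def depth : {In Out : Type} → BoolCircuit In Out → ℕ
  | _, _, output _ => 0
  | _, _, layer _ rest => rest.depth + 1

/-- The number of gates. -/
def size : {In Out : Type} → BoolCircuit In Out → ℕ
  | _, _, output _ => 0
  | _, _, layer (Mid := Mid) _ rest => Fintype.card Mid + rest.size

end BoolCircuit

/-! ### Quantum states and gates -/

/-- The amplitudes in the computational basis of a (not necessarily normalized) vector in the state
space of the qubits labelled by `V`. -/
abbrev QState (V : Type) : Type := (V → Bool) → ℂ

/-- The state in which all qubits are `0`. -/
noncomputable def zeroState (V : Type) : QState V := by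
  classical exact fun x => if ∀ q, x q = false then 1 else 0

/-- The gate set: arbitrary single-qubit unitaries, and CNOT gates on qubits that are adjacent in
the connectivity graph `G`. -/
inductive QGate {V : Type} (G : SimpleGraph V) : Type
  | single (U : Matrix.unitaryGroup Bool ℂ) (q : V) : QGate G
  | cnot (c t : V) (h : G.Adj c t) : QGate G

namespace QGate

variable {V : Type} [DecidableEq V] {G : SimpleGraph V}

/-- The qubits on which a gate acts. -/
def support : QGate G → Finset V
  | single _ q => {q}
  | cnot c t _ => {c, t}

/-- The action of a gate on states; `cnot c t` maps the basis state `x` to the one in which `x t` is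
replaced by `x t xor x c`. -/
noncomputable def apply : QGate G → QState V → QState V
  | single U q, ψ => fun x => ∑ b : Bool, (U : Matrix Bool Bool ℂ) (x q) b *
      ψ (Function.update x q b)
  | cnot c t _, ψ => fun x => ψ (Function.update x t (xor (x t) (x c)))

end QGate

/-- One time step of a quantum circuit: gates on pairwise disjoint sets of qubits. Each gate is
either always applied (`none`), or applied precisely if one specified conventional control bit,
labelled by an element of `B`, is one. -/
structure QStep {V : Type} [DecidableEq V] (G : SimpleGraph V) (B : Type) : Type where
  gates : List (Option B × QGate G)
  disjoint : gates.Pairwise fun g h => Disjoint g.2.support h.2.support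

/-- The action of a step for given values `y` of the control bits. -/
noncomputable def QStep.apply {V : Type} [DecidableEq V] {G : SimpleGraph V} {B : Type}
    (S : QStep G B) (y : B → Bool) (ψ : QState V) : QState V :=
  S.gates.foldl (fun φ g => if g.1.elim true y then g.2.apply φ else φ) ψ

/-- The unnormalized post-measurement state when the qubits in `M` are measured in the computational
basis and the outcomes are given by `m`. -/
noncomputable def measureBranch {V : Type} (M : Finset V) (m : V → Bool) (ψ : QState V) :
    QState V := by
  classical exact fun x => if ∀ q ∈ M, x q = m q then ψ x else 0

/-! ### Alternating quantum-classical circuits -/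

/-- One alternation: a conventional circuit, then a quantum circuit controlled by its output bits,
then a measurement of a subset of the qubits. The input wire `(j, q)` of the conventional circuit
carries the outcome of the measurement of qubit `q` in the earlier alternation number `j`. -/
structure Alternation {V : Type} [DecidableEq V] (G : SimpleGraph V) : Type 1 where
  Control : Type
  conventional : BoolCircuit (ℕ × V) Control
  quantum : List (QStep G Control)
  measured : Finset V

namespace Alternation

variable {V : Type} [DecidableEq V] {G : SimpleGraph V}

/-- Quantum and measurement part of the alternation, given the record `r` of the earlier measurement
outcomes, in the branch in which the measurement has the outcomes `m`. -/
noncomputable def apply (A : Alternation G) (r : ℕ × V → Bool) (m : V → Bool) (ψ : QState V) :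
    QState V :=
  measureBranch A.measured m
    (A.quantum.foldl (fun φ S => S.apply (A.conventional.eval r) φ) ψ)

/-- The record of measurement outcomes after alternation number `i` with outcomes `m`. Wires of
qubits that were not measured, and of later alternations, carry `false`. -/
def record (A : Alternation G) (i : ℕ) (m : V → Bool) (r : ℕ × V → Bool) : ℕ × V → Bool :=
  fun p => if p.1 = i then decide (p.2 ∈ A.measured) && m p.2 else r p

/-- Run a list of alternations, numbered from `i` on, in the branch in which alternation number `j`
has the measurement outcomes `o j`. -/
noncomputable def run (o : ℕ → V → Bool) :
    List (Alternation G) → ℕ → (ℕ × V → Bool) → QState V → QState V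
  | [], _, _, ψ => ψ
  | A :: As, i, r, ψ => run o As (i + 1) (A.record i (o i) r) (A.apply r (o i) ψ)

end Alternation

/-- The unnormalized final state, starting from the all-zeros state, in the branch given by the
measurement outcomes `o`; its squared norm is the probability of the branch. -/
noncomputable def finalState {V : Type} [DecidableEq V] {G : SimpleGraph V}
    (As : List (Alternation G)) (o : ℕ → V → Bool) : QState V :=
  Alternation.run o As 0 (fun _ => false) (zeroState V)

/-- The state `ψ` on the `n` output qubits at the positions `out`, with all other qubits in `0`. -/
noncomputable def withAncillas {V : Type} {n : ℕ} (out : Fin n ↪ V) (ψ : QState (Fin n)) :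
    QState V := by
  classical exact fun x =>
    if ∀ q, q ∉ Set.range out → x q = false then ψ (fun i => x (out i)) else 0

/-- The alternations deterministically prepare `ψ`: whatever the measurement outcomes, they end in
the pure state `ψ` at fixed output positions, with all other qubits in `0`, up to a scalar (a
global phase times the square root of the probability of these outcomes). -/
def Prepares {V : Type} [DecidableEq V] {G : SimpleGraph V} (As : List (Alternation G)) {n : ℕ}
    (ψ : QState (Fin n)) : Prop :=
  ∃ out : Fin n ↪ V, ∀ o : ℕ → V → Bool, ∃ c : ℂ, ∀ x,
    finalState As o x = c * withAncillas out ψ x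

/-- The rectangular grid, in which every vertex is adjacent to its at most four direct neighbors. -/
abbrev gridGraph (rows cols : ℕ) : SimpleGraph (Fin rows × Fin cols) :=
  SimpleGraph.boxProd (SimpleGraph.pathGraph rows) (SimpleGraph.pathGraph cols)

/-- A local alternating quantum-classical circuit on a rectangular grid of qubits. -/
structure LAQCircuit : Type 1 where
  rows : ℕ
  cols : ℕ
  alternations : List (Alternation (gridGraph rows cols))

/-- The number of qubits of the circuit, ancillas included. -/
def LAQCircuit.numQubits (C : LAQCircuit) : ℕ := C.rows * C.cols

/-- The family `C` of circuits, where `C i` has size parameter `n i`, consists of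
LAQCC(QNC⁰, NC¹, O(log n)) circuits (all bounds depend on the size parameter only). -/
structure IsLAQCCLOG {ι : Type} (n : ι → ℕ) (C : ι → LAQCircuit) : Prop where
  /-- all quantum layers have constant depth -/
  quantum : ∃ a : ℕ, ∀ i, ∀ A ∈ (C i).alternations, A.quantum.length ≤ a
  /-- all conventional layers have logarithmic depth and polynomial size -/
  conventional : ∃ (f : ℕ → ℕ) (p : Polynomial ℕ),
    (fun m => (f m : ℝ)) =O[Filter.atTop] (fun m : ℕ => Real.log m) ∧
    ∀ i, ∀ A ∈ (C i).alternations,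
      A.conventional.depth ≤ f (n i) ∧ A.conventional.size ≤ p.eval (n i)
  /-- there are logarithmically many alternations -/
  alternations : ∃ d : ℕ → ℕ,
    (fun m => (d m : ℝ)) =O[Filter.atTop] (fun m : ℕ => Real.log m) ∧
    ∀ i, (C i).alternations.length ≤ d (n i)

/-- The Dicke-`(n, k)` state: the uniform superposition of the `n`-bit strings of Hamming
weight `k`. -/
noncomputable def dickeState (n k : ℕ) : QState (Fin n) :=
  fun x => if (Finset.univ.filter fun i => x i = true).card = k
    then (((Real.sqrt (n.choose k))⁻¹ : ℝ) : ℂ) else 0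

/-!
Toss, for each position `i` and each number `s` of ones that may precede it, a coin qubit with
amplitude `√((k - s) / (n - i))` for a one, and let the bit at `i` be the coin at `(i, s)` for the
number `s` of ones that do precede it. The amplitudes of the coins read along the way multiply to
`(n choose k)^(-1/2)` for each string of weight `k`, so the bits are in the Dicke state once
everything else is erased. Given the bits, a coin on the path of prefix counts equals its bit, a
coin off the path is still in its tossed state and can be untossed, and the path is recomputed from
the bits and removed.

The prefix counts come from products over `𝔽₂` of transition matrices of segments whose lengths
double, so logarithmically many quadratic maps of basis states compute all of them. A quadratic map
consists of the phases `(-1)^(abc)` between Hadamard gates, and such a cubic phase is a product of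
phases of parities of `a`, `b` and `c`.

Constantly many layers of CNOT gates and measurements write any family of parities of the data onto
a grid. The measurement outcomes shift the state by bit flips which are linear over `𝔽₂` in the
outcomes, hence computed in logarithmic depth and corrected. The ancillas are then measured in the
Hadamard basis, which costs signs that are linear as well.
-/

/-! ### Products of single-qubit maps -/

section LocalMap

theorem zeroState_eq_prod {V : Type} [Fintype V] (x : V → Bool) :
    zeroState V x = ∏ q, if x q = false then (1 : ℂ) else 0 := by
  simp [zeroState, Fintype.prod_boole]

variable {V : Type} [Fintype V] [DecidableEq V]

/-- The tensor product of the single-qubit maps `U q`. -/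
def localMap (U : V → Matrix Bool Bool ℂ) (ψ : QState V) : QState V :=
  fun x => ∑ y : V → Bool, (∏ q, U q (x q) (y q)) * ψ y

theorem localMap_smul (U : V → Matrix Bool Bool ℂ) (c : ℂ) (ψ : QState V) :
    localMap U (c • ψ) = c • localMap U ψ := by
  funext x
  simp only [localMap, Pi.smul_apply, smul_eq_mul, Finset.mul_sum, mul_left_comm]

theorem localMap_mul (A B : V → Matrix Bool Bool ℂ) (φ : QState V) :
    localMap A (localMap B φ) = localMap (fun q => A q * B q) φ := by
  funext x
  simp only [localMap, Finset.mul_sum]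
  rw [Finset.sum_comm]
  refine Finset.sum_congr rfl fun y _ => ?_
  simp only [Matrix.mul_apply, Fintype.prod_sum, Finset.sum_mul, Finset.prod_mul_distrib,
    mul_assoc]

theorem localMap_extend {K : Type} [Fintype K] [DecidableEq K] (e : K ↪ V)
    (U : K → Matrix Bool Bool ℂ) (ψ : QState V) (x : V → Bool) :
    localMap (Function.extend e U 1) ψ x =
      localMap U (fun c => ψ (Function.extend e c x)) (x ∘ e) := by
  refine (Fintype.sum_of_injective (fun c : K → Bool => Function.extend e c x)
    (Function.extend_injective e.injective x) _ _ (fun y hy => ?_) fun c => ?_).symm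
  · obtain ⟨q, hq⟩ := Function.ne_iff.mp fun h => hy ⟨y ∘ e, h⟩
    have hqe : ¬∃ k, e k = q := by
      rintro ⟨k, rfl⟩
      exact hq (e.injective.extend_apply _ _ _)
    replace hq : x q ≠ y q := Function.extend_apply' (y ∘ e) x q hqe ▸ hq
    refine mul_eq_zero_of_left (Finset.prod_eq_zero (Finset.mem_univ q) ?_) _
    rw [Function.extend_apply' _ _ _ hqe, Pi.one_apply, Matrix.one_apply_ne hq]
  · congr 1
    refine Fintype.prod_of_injective e e.injective _ _ (fun q hq => ?_) fun k => ?_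
    · rw [Function.extend_apply' _ _ _ hq, Function.extend_apply' _ _ _ hq, Pi.one_apply,
        Matrix.one_apply_eq]
    · simp only [e.injective.extend_apply, Function.comp_apply]

theorem localMap_prod (A : V → Matrix Bool Bool ℂ) (k : V → Bool → ℂ) (x : V → Bool) :
    localMap A (fun y => ∏ q, k q (y q)) x = ∏ q, ∑ b, A q (x q) b * k q b := by
  rw [localMap, Fintype.prod_sum]
  exact Finset.sum_congr rfl fun y _ => Finset.prod_mul_distrib.symm

theorem localMap_zeroState (A : V → Matrix Bool Bool ℂ) (x : V → Bool) :
    localMap A (zeroState V) x = ∏ q, A q (x q) false := by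
  rw [show zeroState V = _ from funext zeroState_eq_prod,
    localMap_prod A fun _ b => if b = false then 1 else 0]
  simp

theorem localMap_of_monomial {U : V → Matrix Bool Bool ℂ} (d : V → Bool → ℂ)
    (σ : V → Bool → Bool) (hU : ∀ q a b, U q a b = if b = σ q a then d q a else 0)
    (ψ : QState V) :
    localMap U ψ = fun x => (∏ q, d q (x q)) * ψ fun q => σ q (x q) := by
  funext x
  rw [localMap, Finset.sum_eq_single fun q => σ q (x q)]
  · simp [hU]
  · intro y _ hy
    obtain ⟨q, hq⟩ := Function.ne_iff.mp hy
    rw [Finset.prod_eq_zero (Finset.mem_univ q) (by rw [hU, if_neg hq]), zero_mul]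
  · simp

theorem localMap_one (ψ : QState V) : localMap (fun _ => 1) ψ = ψ := by
  rw [localMap_of_monomial (fun _ _ => 1) (fun _ => id)
    fun _ a b => by simp [Matrix.one_apply, eq_comm]]
  simp

theorem localMap_diagonal (d : V → Bool → ℂ) (ψ : QState V) :
    localMap (fun q => Matrix.diagonal (d q)) ψ = fun x => (∏ q, d q (x q)) * ψ x :=
  localMap_of_monomial d (fun _ => id)
    (fun q a b => by simp [Matrix.diagonal_apply, eq_comm]) ψ

theorem single_apply_eq_localMap {G : SimpleGraph V} (U : Matrix.unitaryGroup Bool ℂ) (q : V)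
    (ψ : QState V) :
    (QGate.single (G := G) U q).apply ψ =
      localMap (Function.update (fun _ => 1) q (U : Matrix Bool Bool ℂ)) ψ := by
  funext x
  refine Fintype.sum_of_injective (Function.update x q) (Function.update_injective x q) _ _ ?_ ?_
  · intro y hy
    obtain ⟨r, hr⟩ := Function.ne_iff.mp fun h => hy ⟨y q, h⟩
    have hrq : r ≠ q := by
      rintro rfl
      simp at hr
    rw [Function.update_of_ne hrq] at hr
    rw [Finset.prod_eq_zero (Finset.mem_univ r), zero_mul]
    rw [Function.update_of_ne hrq, Matrix.one_apply_ne hr]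
  · intro b
    rw [Finset.prod_eq_single q]
    · simp only [Function.update_self]
    · intro r _ hr
      rw [Function.update_of_ne hr, Function.update_of_ne hr, Matrix.one_apply_eq]
    · simp

theorem foldl_single_apply {G : SimpleGraph V} (ctl : V → Bool)
    (U : V → Matrix.unitaryGroup Bool ℂ) (ψ : QState V) :
    ∀ l : List V, l.Nodup → ∀ W : V → Matrix Bool Bool ℂ,
      l.foldl (fun φ q => if ctl q then (QGate.single (G := G) (U q) q).apply φ else φ)
        (localMap W ψ) =
      localMap (fun q => if q ∈ l ∧ ctl q then (U q : Matrix Bool Bool ℂ) * W q else W q) ψ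
  | [], _, W => by simp
  | a :: l, hl, W => by
    rw [List.nodup_cons] at hl
    have head : (if ctl a then (QGate.single (G := G) (U a) a).apply (localMap W ψ)
        else localMap W ψ) = localMap (fun q => if q = a ∧ ctl a then
          (U a : Matrix Bool Bool ℂ) * W q else W q) ψ := by
      cases ctl a
      · simp
      · simp only [if_true, and_true, single_apply_eq_localMap, localMap_mul]
        congr 1
        funext q
        by_cases hq : q = a <;> simp [hq]
    rw [List.foldl_cons, head, foldl_single_apply ctl U ψ l hl.2]
    congr 1
    funext q
    obtain rfl | hq := eq_or_ne q a
    · simp [hl.1]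
    · simp [hq]

/-- One time step applying the single-qubit gate `U q` to each qubit `q`, controlled by `ctl q`. -/
noncomputable def singleStep {G : SimpleGraph V} {B : Type} (ctl : V → Option B)
    (U : V → Matrix.unitaryGroup Bool ℂ) : QStep G B where
  gates := (Finset.univ : Finset V).toList.map fun q => (ctl q, QGate.single (U q) q)
  disjoint := by
    rw [List.pairwise_map]
    refine (Finset.nodup_toList (Finset.univ : Finset V)).imp fun h => ?_
    simpa [QGate.support] using h

theorem singleStep_apply {G : SimpleGraph V} {B : Type} (ctl : V → Option B)
    (U : V → Matrix.unitaryGroup Bool ℂ) (y : B → Bool) (ψ : QState V) :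
    (singleStep (G := G) ctl U).apply y ψ =
      localMap (fun q => if (ctl q).elim true y = true then (U q : Matrix Bool Bool ℂ) else 1)
        ψ := by
  have h := foldl_single_apply (G := G) (fun q => (ctl q).elim true y) U ψ
    (Finset.univ : Finset V).toList (Finset.nodup_toList _) (fun _ => 1)
  rw [localMap_one] at h
  simpa [QStep.apply, singleStep, List.foldl_map] using h

theorem singleStep_none_apply {G : SimpleGraph V} {B : Type}
    (U : V → Matrix.unitaryGroup Bool ℂ) (y : B → Bool) (ψ : QState V) :
    (singleStep (G := G) (fun _ => none) U).apply y ψ =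
      localMap (fun q => (U q : Matrix Bool Bool ℂ)) ψ :=
  singleStep_apply _ U y ψ

theorem singleStep_some_apply {G : SimpleGraph V} (U : V → Matrix.unitaryGroup Bool ℂ)
    (y : V → Bool) (ψ : QState V) :
    (singleStep (G := G) some U).apply y ψ =
      localMap (fun q => if y q then (U q : Matrix Bool Bool ℂ) else 1) ψ :=
  singleStep_apply _ U y ψ

end LocalMap

/-! ### Signs and single-qubit gates -/

/-- The sign `(-1) ^ b`. -/
def boolSign (b : Bool) : ℂ := if b then -1 else 1

@[simp] theorem boolSign_zero : boolSign 0 = 1 := rfl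

@[simp] theorem boolSign_false : boolSign false = 1 := rfl

@[simp] theorem boolSign_true : boolSign true = -1 := rfl

theorem boolSign_add (a b : Bool) : boolSign (a + b) = boolSign a * boolSign b := by
  cases a <;> cases b <;> simp [Bool.add_eq_xor]

theorem boolSign_sum {ι : Type*} (s : Finset ι) (f : ι → Bool) :
    boolSign (∑ i ∈ s, f i) = ∏ i ∈ s, boolSign (f i) := by
  classical
  induction s using Finset.induction_on with
  | empty => rfl
  | insert a s ha ih => rw [Finset.sum_insert ha, Finset.prod_insert ha, boolSign_add, ih]

theorem boolSign_mul_self (a : Bool) : boolSign a * boolSign a = 1 := by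
  cases a <;> simp

theorem boolSign_mem_unitary (b : Bool) : boolSign b ∈ unitary ℂ := by
  cases b <;> simp [Unitary.mem_iff]

/-- The amplitude `1 / √2`. -/
noncomputable def rootHalf : ℂ := ((Real.sqrt 2)⁻¹ : ℝ)

theorem rootHalf_mul_self : rootHalf * rootHalf = 1 / 2 := by
  rw [rootHalf, ← Complex.ofReal_mul, ← mul_inv, Real.mul_self_sqrt zero_le_two]
  norm_num

/-- The Hadamard gate. -/
noncomputable def hadamard : Matrix Bool Bool ℂ :=
  Matrix.of fun a b => rootHalf * boolSign (a * b)

theorem hadamard_apply (a b : Bool) : hadamard a b = rootHalf * boolSign (a * b) := rfl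

theorem hadamard_mem : hadamard ∈ Matrix.unitaryGroup Bool ℂ := by
  have conj_rootHalf : (starRingEnd ℂ) rootHalf = rootHalf := Complex.conj_ofReal _
  rw [Matrix.mem_unitaryGroup_iff]
  ext a b
  cases a <;> cases b <;>
    norm_num [Matrix.mul_apply, Matrix.star_apply, hadamard_apply, Bool.mul_eq_and,
      conj_rootHalf, rootHalf_mul_self]

/-- The Pauli gate `X`, which exchanges the basis states. -/
def notMatrix : Matrix Bool Bool ℂ := Matrix.of fun a b => if b = !a then 1 else 0

theorem notMatrix_mem : notMatrix ∈ Matrix.unitaryGroup Bool ℂ := by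
  rw [Matrix.mem_unitaryGroup_iff]
  ext a b
  cases a <;> cases b <;> simp [notMatrix, Matrix.mul_apply, Matrix.star_apply]

theorem localMap_not {V : Type} [Fintype V] [DecidableEq V] (b : V → Bool) (ψ : QState V) :
    localMap (fun q => if b q then notMatrix else 1) ψ = fun x => ψ (x + b) := by
  rw [localMap_of_monomial (fun _ _ => 1) (fun q a => a + b q) fun q a a' => by
    cases b q <;> cases a <;> cases a' <;> simp [notMatrix, Bool.add_eq_xor]]
  simp [Pi.add_def]

/-- The diagonal gate with phase `w` on the basis state one. -/
noncomputable def phaseGate (w : unitary ℂ) : Matrix.unitaryGroup Bool ℂ :=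
  ⟨Matrix.diagonal fun b => if b then (w : ℂ) else 1, by
    rw [Matrix.mem_unitaryGroup_iff, Matrix.star_eq_conjTranspose, Matrix.diagonal_conjTranspose,
      Matrix.diagonal_mul_diagonal, Matrix.diagonal_eq_one]
    funext b
    cases b
    · simp
    · exact Unitary.mul_star_self_of_mem w.2⟩

/-! ### Time steps of CNOT gates -/

/-- A set of CNOT gates which can be applied in a single time step: each qubit `q` of `targets` is
the target of one gate, whose control is `control q`. -/
structure CnotPattern {V : Type} (G : SimpleGraph V) where
  targets : Finset V
  control : V → V
  adj : ∀ q ∈ targets, G.Adj (control q) q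
  injOn : Set.InjOn control targets
  control_notMem : ∀ q ∈ targets, control q ∉ targets

namespace CnotPattern

variable {V : Type} [DecidableEq V] {G : SimpleGraph V} (P : CnotPattern G)

/-- The action of the pattern on basis states. -/
def map : (V → Bool) →+ (V → Bool) where
  toFun x q := if q ∈ P.targets then x q + x (P.control q) else x q
  map_zero' := by
    funext q
    simp
  map_add' x y := by
    funext q
    by_cases hq : q ∈ P.targets
    · simp only [if_pos hq, Pi.add_apply, add_add_add_comm]
    · simp only [if_neg hq, Pi.add_apply]

theorem map_of_mem {q : V} (hq : q ∈ P.targets) (x : V → Bool) :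
    P.map x q = x q + x (P.control q) :=
  if_pos hq

theorem map_of_notMem {q : V} (hq : q ∉ P.targets) (x : V → Bool) : P.map x q = x q :=
  if_neg hq

/-- The time step which applies the gates of the pattern. -/
noncomputable def step (B : Type) : QStep G B where
  gates := P.targets.attach.toList.map fun q : P.targets =>
    (none, .cnot (P.control q) q (P.adj q q.2))
  disjoint := by
    rw [List.pairwise_map]
    refine (Finset.nodup_toList _).imp fun {q r} hqr => ?_
    have targets_ne : (q : V) ≠ r := fun h => hqr (Subtype.ext h)
    have controls_ne : P.control q ≠ P.control r := fun h => targets_ne (P.injOn q.2 r.2 h)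
    have control_ne : P.control q ≠ r := fun h => P.control_notMem q q.2 (h ▸ r.2)
    have ne_control : (q : V) ≠ P.control r := fun h => P.control_notMem r r.2 (h ▸ q.2)
    simp [QGate.support, targets_ne, controls_ne, control_ne, ne_control, Finset.disjoint_left]

theorem foldl_cnot_apply (ψ : QState V) : ∀ l : List P.targets, l.Nodup →
    l.foldl (fun φ (q : P.targets) => (QGate.cnot (P.control q) (q : V) (P.adj q q.2)).apply φ) ψ =
      fun x => ψ fun q => if q ∈ l.map Subtype.val then x q + x (P.control q) else x q
  | [], _ => by simp
  | a :: l, hl => by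
    rw [List.nodup_cons] at hl
    rw [List.foldl_cons, foldl_cnot_apply _ l hl.2]
    have control_notMem : P.control a ∉ l.map Subtype.val := fun h => by
      obtain ⟨r, -, hr⟩ := List.mem_map.mp h
      exact P.control_notMem a a.2 (hr ▸ r.2)
    have head_notMem : (a : V) ∉ l.map Subtype.val := by
      simpa using hl.1
    funext x
    change ψ (Function.update _ (a : V) _) = ψ _
    congr 1
    funext q
    simp only [List.map_cons, List.mem_cons]
    obtain rfl | hq := eq_or_ne q a
    · rw [Function.update_self, if_neg control_notMem, if_neg head_notMem, if_pos (.inl rfl),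
        Bool.add_eq_xor]
    · simp only [Function.update_of_ne hq, hq, false_or]

theorem step_apply {B : Type} (y : B → Bool) (ψ : QState V) :
    (P.step B).apply y ψ = fun x => ψ (P.map x) := by
  have h := P.foldl_cnot_apply ψ P.targets.attach.toList (Finset.nodup_toList _)
  simpa [QStep.apply, step, List.foldl_map, map] using h

/-- The action of a sequence of patterns on basis states; the last one acts first, since states are
functions on assignments. -/
def listMap (l : List (CnotPattern G)) : (V → Bool) →+ (V → Bool) :=
  l.foldr (fun P f => P.map.comp f) (.id _)

theorem foldl_step_apply {B : Type} (y : B → Bool) (l : List (CnotPattern G)) (ψ : QState V) :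
    (l.map fun P => P.step B).foldl (fun φ S => S.apply y φ) ψ = fun x => ψ (listMap l x) := by
  induction l generalizing ψ with
  | nil => rfl
  | cons P l ih =>
    rw [List.map_cons, List.foldl_cons, step_apply, ih]
    rfl

end CnotPattern

/-! ### Conventional circuits for linear maps -/

/-- A balanced tree of parities over the cube of dimension `k`, for each output in `Out`. -/
def xorTree (Out : Type) [Fintype Out] : (k : ℕ) → BoolCircuit (Out × (Fin k → Bool)) Out
  | 0 => .output fun o => (o, Fin.elim0)
  -- `a xor b` is `(a or b) and not (a and b)`
  | k + 1 =>
    .layer (Mid := (Out × (Fin k → Bool)) × Bool)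
      (fun p => if p.2 then .or (p.1.1, Fin.cons false p.1.2) (p.1.1, Fin.cons true p.1.2)
        else .and (p.1.1, Fin.cons false p.1.2) (p.1.1, Fin.cons true p.1.2)) <|
    .layer (Mid := (Out × (Fin k → Bool)) × Bool)
      (fun p => if p.2 then .wire p else .not p) <|
    .layer (Mid := Out × (Fin k → Bool)) (fun p => .and (p, false) (p, true)) (xorTree Out k)

theorem xorTree_eval (Out : Type) [Fintype Out] : ∀ (k : ℕ) (v : Out × (Fin k → Bool) → Bool)
    (o : Out), (xorTree Out k).eval v o = ∑ y : Fin k → Bool, v (o, y)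
  | 0, v, o => by
    rw [Fintype.sum_unique, xorTree, BoolCircuit.eval]
    exact congrArg _ (Prod.ext rfl (Subsingleton.elim _ _))
  | k + 1, v, o => by
    simp only [xorTree, BoolCircuit.eval]
    rw [xorTree_eval Out k, ← (Fin.consEquiv fun _ => Bool).sum_comp, Fintype.sum_prod_type_right]
    refine Finset.sum_congr rfl fun y _ => ?_
    rw [Fintype.sum_bool]
    simp only [BoolGate.eval, Fin.consEquiv, Equiv.coe_fn_mk, Bool.add_eq_xor, if_true,
      Bool.false_eq_true, if_false]
    cases v (o, Fin.cons false y) <;> cases v (o, Fin.cons true y) <;> rfl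

theorem xorTree_depth (Out : Type) [Fintype Out] : ∀ k : ℕ, (xorTree Out k).depth = 3 * k
  | 0 => rfl
  | k + 1 => by simp only [xorTree, BoolCircuit.depth, xorTree_depth Out k]; ring

theorem xorTree_size_le (Out : Type) [Fintype Out] :
    ∀ k : ℕ, (xorTree Out k).size ≤ 5 * (Fintype.card Out * 2 ^ k)
  | 0 => by simp [xorTree, BoolCircuit.size]
  | k + 1 => by
    have := xorTree_size_le Out k
    simp only [xorTree, BoolCircuit.size, Fintype.card_prod, Fintype.card_bool,
      Fintype.card_pi, Finset.prod_const, Finset.card_univ, Fintype.card_fin, pow_succ]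
    linarith

theorem addMonoidHom_apply_eq_sum {V W : Type*} [Fintype V] [DecidableEq V]
    (f : (V → Bool) →+ (W → Bool)) (x : V → Bool) (q : W) :
    f x q = ∑ p, f (Pi.single p 1) q * x p := by
  conv_lhs => rw [← Finset.univ_sum_single x, map_sum, Finset.sum_apply]
  refine Finset.sum_congr rfl fun p _ => ?_
  cases h : x p
  · rw [show (false : Bool) = 0 from rfl, Pi.single_zero, map_zero, mul_zero]; rfl
  · rw [show (true : Bool) = 1 from rfl, mul_one]

section LinearCircuit

variable {V : Type} [Fintype V]

/-- An embedding of `V` into the leaves of a parity tree of logarithmic depth. -/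
noncomputable def leafOf (V : Type) [Fintype V] :
    V ↪ (Fin (Nat.clog 2 (Fintype.card V)) → Bool) :=
  (Function.Embedding.nonempty_of_card_le
    (by simpa using Nat.le_pow_clog (by norm_num) (Fintype.card V))).some

variable [DecidableEq V]

/-- The gate which provides the summand `f (Pi.single p 1) q * x p` of output `q` of `f`, for the
outcomes `x` of alternation number `j`, at the leaf of `p`. -/
noncomputable def leafGate (f : (V → Bool) →+ (V → Bool)) (j : ℕ) (q : V) :
    (Fin (Nat.clog 2 (Fintype.card V)) → Bool) → BoolGate (ℕ × V) :=
  Function.extend (leafOf V)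
    (fun p => if f (Pi.single p 1) q then .wire (j, p) else .const false)
    fun _ => .const false

/-- A circuit which applies the linear map `f` to the outcomes of alternation number `j`. -/
noncomputable def linearCircuit (f : (V → Bool) →+ (V → Bool)) (j : ℕ) : BoolCircuit (ℕ × V) V :=
  .layer (fun p : V × (Fin (Nat.clog 2 (Fintype.card V)) → Bool) => leafGate f j p.1 p.2)
    (xorTree V _)

theorem linearCircuit_eval (f : (V → Bool) →+ (V → Bool)) (j : ℕ) (r : ℕ × V → Bool) :
    (linearCircuit f j).eval r = f fun q => r (j, q) := by
  funext q
  rw [linearCircuit, BoolCircuit.eval, xorTree_eval, addMonoidHom_apply_eq_sum]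
  symm
  refine Fintype.sum_of_injective (leafOf V) (leafOf V).injective _ _ (fun y hy => ?_)
    fun p => ?_
  · rw [leafGate, Function.extend_apply' _ _ _ hy]
    rfl
  · rw [leafGate, (leafOf V).injective.extend_apply]
    cases f (Pi.single p 1) q <;> simp [BoolGate.eval, Bool.mul_eq_and]

theorem linearCircuit_depth (f : (V → Bool) →+ (V → Bool)) (j : ℕ) :
    (linearCircuit f j).depth = 3 * Nat.clog 2 (Fintype.card V) + 1 := by
  rw [linearCircuit, BoolCircuit.depth, xorTree_depth]

theorem linearCircuit_size_le (f : (V → Bool) →+ (V → Bool)) (j : ℕ) :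
    (linearCircuit f j).size ≤
      6 * (Fintype.card V * 2 ^ Nat.clog 2 (Fintype.card V)) := by
  have := xorTree_size_le V (Nat.clog 2 (Fintype.card V))
  simp only [linearCircuit, BoolCircuit.size, Fintype.card_prod, Fintype.card_bool,
    Fintype.card_pi, Finset.prod_const, Finset.card_univ, Fintype.card_fin]
  linarith

end LinearCircuit

/-! ### Parities by measurement and feedforward -/

section EmbedState

variable {V Λ : Type}

/-- The state `φ` on the qubits `data`, with all other qubits in `0`. -/
noncomputable def embedState (data : Λ ↪ V) (φ : QState Λ) : QState V :=
  Set.indicator {x | ∀ q ∉ Set.range data, x q = 0} fun x => φ fun i => x (data i)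

theorem embedState_smul (data : Λ ↪ V) (c : ℂ) (φ : QState Λ) :
    embedState data (c • φ) = c • embedState data φ :=
  Set.indicator_const_smul _ c _

theorem range_extend_zero (data : Λ ↪ V) :
    Set.range (fun z : Λ → Bool => Function.extend data z 0) =
      {x | ∀ q ∉ Set.range data, x q = 0} := by
  refine Set.Subset.antisymm ?_ fun x hx => ⟨fun i => x (data i), funext fun q => ?_⟩
  · rintro _ ⟨z, rfl⟩ q hq
    exact Function.extend_apply' _ _ _ hq
  · by_cases hq : q ∈ Set.range data
    · obtain ⟨i, rfl⟩ := hq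
      exact data.injective.extend_apply _ _ i
    · beta_reduce
      rw [Function.extend_apply' _ _ _ hq, hx q hq, Pi.zero_apply]

theorem localMap_embedState [Fintype V] [DecidableEq V] [Fintype Λ] [DecidableEq Λ]
    (data : Λ ↪ V) (W : V → Matrix Bool Bool ℂ) (φ : QState Λ) (x : V → Bool) :
    localMap W (embedState data φ) x =
      (∏ q ∈ Finset.univ \ Finset.univ.map data, W q (x q) 0) *
        localMap (fun i => W (data i)) φ (fun i => x (data i)) := by
  rw [localMap, localMap, Finset.mul_sum]
  symm
  refine Fintype.sum_of_injective (fun z => Function.extend data z 0)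
    (Function.extend_injective data.injective 0) _ _ (fun y hy => ?_) fun z => ?_
  · rw [range_extend_zero] at hy
    rw [embedState, Set.indicator_of_notMem hy, mul_zero]
  · have hz : Function.extend data z 0 ∈ {x | ∀ q ∉ Set.range data, x q = 0} :=
      range_extend_zero data ▸ ⟨z, rfl⟩
    rw [embedState, Set.indicator_of_mem hz,
      ← Finset.prod_sdiff (Finset.subset_univ (Finset.univ.map data)), Finset.prod_map]
    simp only [data.injective.extend_apply, ← mul_assoc]
    congr 2
    refine Finset.prod_congr rfl fun q hq => ?_
    rw [hz q (by simpa using hq)]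

end EmbedState

theorem measureBranch_eq_indicator {V : Type} (M : Finset V) (m : V → Bool) (ψ : QState V) :
    measureBranch M m ψ = Set.indicator {x | ∀ q ∈ M, x q = m q} ψ := by
  funext x
  by_cases hx : ∀ q ∈ M, x q = m q
  · exact (if_pos hx).trans
      (Set.indicator_of_mem (s := {x : V → Bool | ∀ q ∈ M, x q = m q}) hx _).symm
  · exact (if_neg hx).trans
      (Set.indicator_of_notMem (s := {x : V → Bool | ∀ q ∈ M, x q = m q}) hx _).symm

section Transpose

variable {V : Type*} [Fintype V] [DecidableEq V]

/-- The transpose of a linear map over the field of two elements. -/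
def boolTranspose (f : (V → Bool) →+ (V → Bool)) : (V → Bool) →+ (V → Bool) where
  toFun h q := ∑ p, h p * f (Pi.single q 1) p
  map_zero' := by
    funext q
    simp
  map_add' h h' := by
    funext q
    simp [add_mul, Finset.sum_add_distrib]

theorem sum_boolTranspose_mul (f : (V → Bool) →+ (V → Bool)) (h x : V → Bool) :
    ∑ q, boolTranspose f h q * x q = ∑ p, h p * f x p := by
  simp only [boolTranspose, AddMonoidHom.coe_mk, ZeroHom.coe_mk, Finset.sum_mul,
    addMonoidHom_apply_eq_sum f x, Finset.mul_sum, mul_assoc]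
  exact Finset.sum_comm

end Transpose

/-- The phase which the diagonal gates `w θ`, controlled by the parities `parity`, give to the
basis state `z`. -/
noncomputable def parityPhase {Λ Θ : Type} [Fintype Θ] (parity : (Λ → Bool) →+ (Θ → Bool))
    (w : Θ → unitary ℂ) (z : Λ → Bool) : ℂ :=
  ∏ θ, if parity z θ then (w θ : ℂ) else 1

/-- A constant number of CNOT layers by which the parities `parity` of the data qubits are
written into ancillas. The ancillas `anc` are prepared in `|+⟩`; the layers `steps` change the
qubits `meas`, which start in `0` and are then measured. The outcome zero forces the ancillas
`acc θ` to carry the parities; by `eq_zero` and `card_eq`, any other outcome amounts to bit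
flips. -/
structure ParityGadget {V : Type} [DecidableEq V] (G : SimpleGraph V) {Λ Θ : Type}
    (parity : (Λ → Bool) →+ (Θ → Bool)) where
  data : Λ ↪ V
  anc : Finset V
  meas : Finset V
  steps : List (QStep G V)
  effect : (V → Bool) →+ (V → Bool)
  steps_apply : ∀ y ψ, steps.foldl (fun φ S => S.apply y φ) ψ = fun x => ψ (effect x)
  effect_of_notMem : ∀ x, ∀ q ∉ meas, effect x q = x q
  data_notMem_anc : ∀ i, data i ∉ anc
  data_notMem_meas : ∀ i, data i ∉ meas
  disjoint : Disjoint anc meas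
  card_eq : anc.card = meas.card
  eq_zero : ∀ x, (∀ q ∉ anc, x q = 0) → (∀ q ∈ meas, effect x q = 0) → x = 0
  acc : Θ ↪ V
  apply_acc : ∀ x, (∀ q ∈ meas, x q = 0) → (∀ q ∈ meas, effect x q = 0) →
    ∀ θ, x (acc θ) = parity (fun i => x (data i)) θ

namespace ParityGadget

section Linear

variable {V : Type} [DecidableEq V] {G : SimpleGraph V} {Λ Θ : Type}
  {parity : (Λ → Bool) →+ (Θ → Bool)} (g : ParityGadget G parity)

theorem eq_of_effect_eq {x y : V → Bool} (h : ∀ q ∉ g.anc, x q = y q)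
    (h' : ∀ q ∈ g.meas, g.effect x q = g.effect y q) : x = y := by
  refine sub_eq_zero.mp (g.eq_zero (x - y) (fun q hq => ?_) fun q hq => ?_)
  · rw [Pi.sub_apply, h q hq, sub_self]
  · rw [map_sub, Pi.sub_apply, h' q hq, sub_self]

/-- The assignments in which all qubits except data and ancillas are zero. -/
def clean : Set (V → Bool) := {x | ∀ q ∉ Set.range g.data, q ∉ g.anc → x q = 0}

theorem apply_meas_of_mem_clean {x : V → Bool} (hx : x ∈ g.clean) {q : V} (hq : q ∈ g.meas) :
    x q = 0 := by
  refine hx q ?_ (Finset.disjoint_right.mp g.disjoint hq)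
  rintro ⟨i, rfl⟩
  exact g.data_notMem_meas i hq

theorem exists_completion [Finite V] (y : V → Bool) :
    ∃ x, (∀ q ∉ g.anc, x q = y q) ∧ ∀ q ∈ g.meas, g.effect x q = 0 := by
  cases nonempty_fintype V
  let coords (x : V → Bool) : ({q // q ∉ g.anc} → Bool) × (g.meas → Bool) :=
    (fun q => x q, fun q => g.effect x q)
  have coords_injective : coords.Injective := fun x x' h =>
    g.eq_of_effect_eq (fun q hq => congrFun (congrArg Prod.fst h) ⟨q, hq⟩)
      fun q hq => congrFun (congrArg Prod.snd h) ⟨q, hq⟩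
  have card_eq : Fintype.card (V → Bool) =
      Fintype.card (({q // q ∉ g.anc} → Bool) × (g.meas → Bool)) := by
    have := Finset.card_le_univ g.anc
    simp only [Fintype.card_prod, Fintype.card_fun, Fintype.card_bool, Fintype.card_coe,
      Fintype.card_subtype_compl, ← g.card_eq, ← pow_add, Nat.sub_add_cancel this]
  obtain ⟨x, hx⟩ :=
    ((Fintype.bijective_iff_injective_and_card coords).mpr ⟨coords_injective, card_eq⟩).surjective
      (fun q => y q, 0)
  exact ⟨x, fun q hq => congrFun (congrArg Prod.fst hx) ⟨q, hq⟩,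
    fun q hq => congrFun (congrArg Prod.snd hx) ⟨q, hq⟩⟩

variable [Finite V]

/-- The assignment that agrees with `y` off the ancillas and gives the measurement outcome zero. -/
noncomputable def complete : (V → Bool) →+ (V → Bool) :=
  AddMonoidHom.mk' (fun y => (g.exists_completion y).choose) fun y y' => by
    have h := (g.exists_completion y).choose_spec
    have h' := (g.exists_completion y').choose_spec
    have hadd := (g.exists_completion (y + y')).choose_spec
    refine g.eq_of_effect_eq (fun q hq => ?_) fun q hq => ?_
    · simp only [Pi.add_apply, hadd.1 q hq, h.1 q hq, h'.1 q hq]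
    · simp only [map_add, Pi.add_apply, hadd.2 q hq, h.2 q hq, h'.2 q hq, add_zero]

theorem complete_of_notMem (y : V → Bool) {q : V} (hq : q ∉ g.anc) : g.complete y q = y q :=
  (g.exists_completion y).choose_spec.1 q hq

theorem effect_complete (y : V → Bool) {q : V} (hq : q ∈ g.meas) :
    g.effect (g.complete y) q = 0 :=
  (g.exists_completion y).choose_spec.2 q hq

theorem complete_eq_zero {y : V → Bool} (hy : ∀ q ∉ g.anc, y q = 0) : g.complete y = 0 :=
  g.eq_zero _ (fun q hq => by rw [g.complete_of_notMem y hq, hy q hq])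
    fun _ hq => g.effect_complete y hq

theorem mem_codeState_support_iff {c m x : V → Bool} (hc : ∀ q ∈ g.meas, c q = m q)
    (hc' : ∀ q ∉ g.meas, c q = 0) :
    x + g.complete c ∈ g.clean ∩ {x | ∀ q ∈ g.meas, g.effect x q = 0} ↔
      (∀ q ∈ g.meas, x q = m q) ∧ g.effect x ∈ g.clean := by
  have add_meas : ∀ q ∈ g.meas, (x + g.complete c) q = 0 ↔ x q = m q := fun q hq => by
    rw [Pi.add_apply, g.complete_of_notMem c (Finset.disjoint_right.mp g.disjoint hq), hc q hq]
    cases x q <;> cases m q <;> decide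
  have add_rest : ∀ q ∉ g.meas, q ∉ g.anc → (x + g.complete c) q = g.effect x q :=
    fun q hq hq' => by
      rw [Pi.add_apply, g.complete_of_notMem c hq', hc' q hq, add_zero, g.effect_of_notMem x q hq]
  have effect_add : ∀ q ∈ g.meas, g.effect (x + g.complete c) q = g.effect x q := fun q hq => by
    rw [map_add, Pi.add_apply, g.effect_complete c hq, add_zero]
  refine ⟨fun ⟨hx, hx'⟩ => ⟨fun q hq => (add_meas q hq).mp (g.apply_meas_of_mem_clean hx hq),
    fun q hq hq' => ?_⟩, fun ⟨hx, hx'⟩ => ⟨fun q hq hq' => ?_, fun q hq => ?_⟩⟩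
  · by_cases hqm : q ∈ g.meas
    · rw [← effect_add q hqm, hx' q hqm]
    · rw [← add_rest q hqm hq', hx q hq hq']
  · by_cases hqm : q ∈ g.meas
    · exact (add_meas q hqm).mpr (hx q hqm)
    · rw [add_rest q hqm hq', hx' q hq hq']
  · rw [effect_add q hq, g.apply_meas_of_mem_clean hx' hq]

end Linear

section Semantics

variable {V : Type} [Fintype V] [DecidableEq V] {G : SimpleGraph V} {Λ Θ : Type}
  {parity : (Λ → Bool) →+ (Θ → Bool)} (g : ParityGadget G parity)

/-- The state `χ` of the data, with the ancillas completed to measurement outcome zero. -/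
noncomputable def codeState (χ : QState Λ) : QState V :=
  Set.indicator (g.clean ∩ {x | ∀ q ∈ g.meas, g.effect x q = 0}) fun x => χ fun i => x (g.data i)

/-- The gates before the ancillas are coupled to the data. -/
noncomputable def initGate (U : Λ → Matrix.unitaryGroup Bool ℂ) (q : V) :
    Matrix.unitaryGroup Bool ℂ :=
  if q ∈ g.anc then ⟨hadamard, hadamard_mem⟩ else Function.extend g.data U 1 q

/-- The phase gates on the parities. -/
noncomputable def accGate (w : Θ → unitary ℂ) (q : V) : Matrix.unitaryGroup Bool ℂ :=
  phaseGate (Function.extend g.acc w 1 q)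

/-- The corrections after the second measurement. -/
noncomputable def backGate (q : V) : Matrix.unitaryGroup Bool ℂ :=
  if q ∈ g.anc then ⟨notMatrix, notMatrix_mem⟩ else phaseGate ⟨-1, boolSign_mem_unitary true⟩

/-- The first alternation: `U` on the data, then the coupling of the ancillas. -/
noncomputable def couple (U : Λ → Matrix.unitaryGroup Bool ℂ) : Alternation G where
  Control := V
  conventional := .output fun q => (0, q)
  quantum := singleStep (fun _ => none) (g.initGate U) :: g.steps
  measured := g.meas

/-- The second alternation: bit flips to outcome zero, phases, and measurement of the ancillas in
the Hadamard basis. -/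
noncomputable def accumulate (w : Θ → unitary ℂ) (j : ℕ) : Alternation G where
  Control := V
  conventional := linearCircuit g.complete j
  quantum := [singleStep some fun _ => ⟨notMatrix, notMatrix_mem⟩,
    singleStep (fun _ => none) (g.accGate w),
    singleStep (fun _ => none) fun q => if q ∈ g.anc then ⟨hadamard, hadamard_mem⟩ else 1]
  measured := g.anc

/-- The third alternation: reset of the ancillas and correction of the data. -/
noncomputable def restore (j : ℕ) : Alternation G where
  Control := V
  conventional := linearCircuit (AddMonoidHom.id _ + boolTranspose g.complete) j
  quantum := [singleStep some g.backGate]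
  measured := ∅

/-- The alternations for the gates `U` followed by the phases `w` of the parities, if they start
with alternation number `j`. -/
noncomputable def alternations (U : Λ → Matrix.unitaryGroup Bool ℂ) (w : Θ → unitary ℂ) (j : ℕ) :
    List (Alternation G) :=
  [g.couple U, g.accumulate w j, g.restore (j + 1)]

/-- The normalization factor of one measurement. -/
noncomputable def amplitude : ℂ := rootHalf ^ g.anc.card

theorem prod_initGate_apply [Fintype Λ] (U : Λ → Matrix.unitaryGroup Bool ℂ) (x : V → Bool) :
    ∏ q ∈ Finset.univ \ Finset.univ.map g.data, (g.initGate U q : Matrix Bool Bool ℂ) (x q) 0 =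
      g.clean.indicator (fun _ => g.amplitude) x := by
  have gate_apply : ∀ q ∈ Finset.univ \ Finset.univ.map g.data, q ∉ g.anc →
      (g.initGate U q : Matrix Bool Bool ℂ) (x q) 0 = if x q = 0 then 1 else 0 := fun q hq hq' => by
    rw [initGate, if_neg hq', Function.extend_apply' _ _ _ (by simpa using hq)]
    exact Matrix.one_apply
  have anc_subset : g.anc ⊆ Finset.univ \ Finset.univ.map g.data := fun q hq => by
    simp only [Finset.mem_sdiff, Finset.mem_univ, true_and, Finset.mem_map, not_exists]
    rintro i rfl
    exact g.data_notMem_anc i hq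
  by_cases hx : x ∈ g.clean
  · rw [Set.indicator_of_mem hx, ← Finset.prod_sdiff anc_subset, Finset.prod_eq_one, one_mul,
      Finset.prod_congr rfl (g := fun _ => rootHalf), Finset.prod_const, amplitude]
    · intro q hq
      simp only [initGate, if_pos hq, hadamard_apply, mul_zero, boolSign_zero, mul_one]
    · intro q hq
      rw [Finset.mem_sdiff] at hq
      rw [gate_apply q hq.1 hq.2, if_pos (hx q (by simpa using hq.1) hq.2)]
  · rw [Set.indicator_of_notMem hx]
    simp only [clean, Set.mem_ofPred_eq, not_forall] at hx
    obtain ⟨q, hq, hq', hxq⟩ := hx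
    have hq : q ∈ Finset.univ \ Finset.univ.map g.data := by simpa using hq
    exact Finset.prod_eq_zero hq (by rw [gate_apply q hq hq', if_neg hxq])

theorem localMap_initGate_embedState [Fintype Λ] [DecidableEq Λ]
    (U : Λ → Matrix.unitaryGroup Bool ℂ) (φ : QState Λ) :
    localMap (fun q => (g.initGate U q : Matrix Bool Bool ℂ)) (embedState g.data φ) =
      g.clean.indicator fun x =>
        g.amplitude * localMap (fun i => (U i : Matrix Bool Bool ℂ)) φ fun i => x (g.data i) := by
  have initGate_data : ∀ i, g.initGate U (g.data i) = U i := fun i => by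
    rw [initGate, if_neg (g.data_notMem_anc i), g.data.injective.extend_apply]
  funext x
  simp only [localMap_embedState, g.prod_initGate_apply, initGate_data, Set.indicator_mul_left]

theorem localMap_accGate_codeState [Fintype Θ] (w : Θ → unitary ℂ) (χ : QState Λ) :
    localMap (fun q => (g.accGate w q : Matrix Bool Bool ℂ)) (g.codeState χ) =
      g.codeState fun z => parityPhase parity w z * χ z := by
  have prod_eq (x : V → Bool) :
      (∏ q, if x q then ((Function.extend g.acc w 1 q : unitary ℂ) : ℂ) else 1) =
        ∏ θ, if x (g.acc θ) then (w θ : ℂ) else 1 := by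
    symm
    refine Fintype.prod_of_injective g.acc g.acc.injective _ _ (fun q hq => ?_) fun θ => ?_
    · rw [Function.extend_apply' _ _ _ hq, Pi.one_apply, OneMemClass.coe_one, ite_self]
    · rw [g.acc.injective.extend_apply]
  funext x
  have localMap_eq := congrFun (localMap_diagonal
    (fun q b => if b then ((Function.extend g.acc w 1 q : unitary ℂ) : ℂ) else 1)
    (g.codeState χ)) x
  refine localMap_eq.trans ?_
  rw [prod_eq]
  by_cases hx : x ∈ g.clean ∩ {x | ∀ q ∈ g.meas, g.effect x q = 0}
  · rw [codeState, codeState, Set.indicator_of_mem hx, Set.indicator_of_mem hx, parityPhase]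
    simp only [g.apply_acc x (fun _ => g.apply_meas_of_mem_clean hx.1) hx.2]
  · rw [codeState, codeState, Set.indicator_of_notMem hx, Set.indicator_of_notMem hx, mul_zero]

/-- The code state `χ` after Hadamard gates on the ancillas. -/
noncomputable def signedState (χ : QState Λ) : QState V :=
  g.clean.indicator fun x =>
    g.amplitude * boolSign (∑ q ∈ g.anc, x q * g.complete x q) * χ fun i => x (g.data i)

-- Among the assignments with prescribed values off the ancillas, only the completion has
-- measurement outcome zero, so a single term survives in the sum over the ancillas.
theorem localMap_hadamard_codeState (χ : QState Λ) :
    localMap (fun q => if q ∈ g.anc then hadamard else 1) (g.codeState χ) =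
      g.signedState χ := by
  funext x
  have complete_data : ∀ i, g.complete x (g.data i) = x (g.data i) := fun i =>
    g.complete_of_notMem x (g.data_notMem_anc i)
  have complete_mem : g.complete x ∈ g.clean ∩ {x | ∀ q ∈ g.meas, g.effect x q = 0} ↔
      x ∈ g.clean := by
    rw [Set.mem_inter_iff, and_iff_left
      (show g.complete x ∈ {x | ∀ q ∈ g.meas, g.effect x q = 0} from
        fun q hq => g.effect_complete x hq)]
    exact forall₃_congr fun q _ hq => by rw [g.complete_of_notMem x hq]
  have prod_eq : (∏ q, (if q ∈ g.anc then hadamard else 1) (x q) (g.complete x q)) =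
      g.amplitude * boolSign (∑ q ∈ g.anc, x q * g.complete x q) := by
    rw [← Finset.prod_sdiff (Finset.subset_univ g.anc), Finset.prod_eq_one, one_mul,
      boolSign_sum, amplitude, ← Finset.prod_const, ← Finset.prod_mul_distrib]
    · refine Finset.prod_congr rfl fun q hq => ?_
      rw [if_pos hq, hadamard_apply]
    · intro q hq
      rw [Finset.mem_sdiff] at hq
      rw [if_neg hq.2, g.complete_of_notMem x hq.2, Matrix.one_apply_eq]
  rw [localMap, Finset.sum_eq_single (g.complete x), prod_eq]
  · by_cases hx : x ∈ g.clean
    · rw [codeState, signedState, Set.indicator_of_mem (complete_mem.mpr hx),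
        Set.indicator_of_mem hx]
      simp only [complete_data]
    · rw [codeState, signedState, Set.indicator_of_notMem (mt complete_mem.mp hx),
        Set.indicator_of_notMem hx, mul_zero]
  · intro y _ hy
    by_cases hy' : y ∈ g.clean ∩ {x | ∀ q ∈ g.meas, g.effect x q = 0}
    · have exists_ne : ∃ q ∉ g.anc, x q ≠ y q := by
        by_contra! h
        refine hy (g.eq_of_effect_eq (fun q hq => ?_) fun q hq => ?_)
        · rw [g.complete_of_notMem x hq, h q hq]
        · rw [hy'.2 q hq, g.effect_complete x hq]
      obtain ⟨q, hq, hne⟩ := exists_ne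
      rw [Finset.prod_eq_zero (Finset.mem_univ q), zero_mul]
      rw [if_neg hq, Matrix.one_apply_ne hne]
    · rw [codeState, Set.indicator_of_notMem hy', mul_zero]
  · simp

theorem localMap_backGate {h : V → Bool} (hh : ∀ q ∉ g.anc, h q = 0) (ψ : QState V) :
    localMap (fun q => if (h + boolTranspose g.complete h) q then
      (g.backGate q : Matrix Bool Bool ℂ) else 1) ψ =
      fun x => boolSign (∑ q, h q * g.complete x q) * ψ (x + h) := by
  have transpose_anc : ∀ q ∈ g.anc, boolTranspose g.complete h q = 0 := fun q hq => by
    refine Finset.sum_eq_zero fun p _ => ?_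
    rw [g.complete_eq_zero fun r hr => Pi.single_eq_of_ne (ne_of_mem_of_not_mem hq hr).symm _,
      Pi.zero_apply, mul_zero]
  rw [localMap_of_monomial (fun q a => boolSign (boolTranspose g.complete h q * a))
    fun q a => a + h q]
  · funext x
    rw [← sum_boolTranspose_mul, boolSign_sum]
    rfl
  · intro q a b
    by_cases hq : q ∈ g.anc
    · simp only [Pi.add_apply, transpose_anc q hq, add_zero, zero_mul, boolSign_zero, backGate,
        if_pos hq]
      cases h q <;> cases a <;> cases b <;> simp [notMatrix, Bool.add_eq_xor]
    · simp only [Pi.add_apply, hh q hq, zero_add, add_zero, backGate, if_neg hq]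
      cases boolTranspose g.complete h q <;> cases a <;> cases b <;>
        simp [phaseGate, Bool.mul_eq_and]

-- By linearity, the outcome of the first measurement shifts the code state by a completion.
theorem couple_apply [Fintype Λ] [DecidableEq Λ] (U : Λ → Matrix.unitaryGroup Bool ℂ)
    (r : ℕ × V → Bool) {c m : V → Bool} (hc : ∀ q ∈ g.meas, c q = m q)
    (hc' : ∀ q ∉ g.meas, c q = 0) (φ : QState Λ) :
    (g.couple U).apply r m (embedState g.data φ) = fun x =>
      g.codeState (g.amplitude • localMap (fun i => (U i : Matrix Bool Bool ℂ)) φ)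
        (x + g.complete c) := by
  simp only [Alternation.apply, couple, List.foldl_cons, g.steps_apply,
    singleStep_none_apply, localMap_initGate_embedState, measureBranch_eq_indicator]
  funext x
  have data_eq : ∀ i, (x + g.complete c) (g.data i) = g.effect x (g.data i) := fun i => by
    rw [Pi.add_apply, g.complete_of_notMem c (g.data_notMem_anc i), hc' _ (g.data_notMem_meas i),
      add_zero, g.effect_of_notMem x _ (g.data_notMem_meas i)]
  by_cases hx : x + g.complete c ∈ g.clean ∩ {x | ∀ q ∈ g.meas, g.effect x q = 0}
  · have hx' := (g.mem_codeState_support_iff hc hc').mp hx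
    rw [codeState, Set.indicator_of_mem hx,
      Set.indicator_of_mem (s := {x : V → Bool | ∀ q ∈ g.meas, x q = m q}) hx'.1,
      Set.indicator_of_mem hx'.2]
    simp only [data_eq, Pi.smul_apply, smul_eq_mul]
  · rw [codeState, Set.indicator_of_notMem hx]
    rw [g.mem_codeState_support_iff hc hc', not_and] at hx
    exact Set.indicator_apply_eq_zero.mpr fun hxm => Set.indicator_of_notMem (hx hxm) _

theorem accumulate_apply [Fintype Θ] (w : Θ → unitary ℂ) (j : ℕ) (r : ℕ × V → Bool)
    (m : V → Bool) (χ : QState Λ) :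
    (g.accumulate w j).apply r m
        (fun x => g.codeState χ (x + g.complete fun q => r (j, q))) =
      measureBranch g.anc m (g.signedState fun z => parityPhase parity w z * χ z) := by
  have add_add_self (x e : V → Bool) : x + e + e = x := by
    funext q
    rw [Pi.add_apply, Pi.add_apply, add_assoc, Bool.add_eq_xor, Bool.add_eq_xor, Bool.xor_self,
      Bool.xor_false]
  simp only [Alternation.apply, accumulate, List.foldl_cons, List.foldl_nil,
    singleStep_some_apply, singleStep_none_apply, linearCircuit_eval, localMap_not, add_add_self,
    localMap_accGate_codeState, apply_ite Subtype.val, OneMemClass.coe_one,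
    localMap_hadamard_codeState]

theorem boolSign_mul_signedState {h : V → Bool} (hh : ∀ q ∉ g.anc, h q = 0) (χ : QState Λ)
    {x : V → Bool} (hx : ∀ q ∈ g.anc, x q = 0) :
    boolSign (∑ q, h q * g.complete x q) * g.signedState χ (x + h) =
      embedState g.data (g.amplitude • χ) x := by
  have data_eq : ∀ i, (x + h) (g.data i) = x (g.data i) := fun i => by
    rw [Pi.add_apply, hh _ (g.data_notMem_anc i), add_zero]
  have sign_eq : ∑ q ∈ g.anc, (x + h) q * g.complete (x + h) q = ∑ q, h q * g.complete x q := by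
    rw [← Finset.sum_subset (Finset.subset_univ g.anc)]
    · refine Finset.sum_congr rfl fun q hq => ?_
      rw [map_add, g.complete_eq_zero hh, add_zero, Pi.add_apply, hx q hq, zero_add]
    · intro q _ hq
      rw [hh q hq, zero_mul]
  have mem_iff : x + h ∈ g.clean ↔ x ∈ {x | ∀ q ∉ Set.range g.data, x q = 0} := by
    refine forall₂_congr fun q _ => ⟨fun hq => ?_, fun hq hq' => ?_⟩
    · by_cases hqa : q ∈ g.anc
      · exact hx q hqa
      · rw [← hq hqa, Pi.add_apply, hh q hqa, add_zero]
    · rw [Pi.add_apply, hq, hh q hq', add_zero]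
  by_cases hxm : x + h ∈ g.clean
  · rw [signedState, Set.indicator_of_mem hxm, embedState, Set.indicator_of_mem (mem_iff.mp hxm),
      sign_eq, mul_assoc, mul_left_comm, ← mul_assoc (boolSign _), boolSign_mul_self, one_mul]
    simp only [data_eq, Pi.smul_apply, smul_eq_mul]
  · rw [signedState, Set.indicator_of_notMem hxm, embedState,
      Set.indicator_of_notMem (mt mem_iff.mpr hxm), mul_zero]

theorem restore_apply (j : ℕ) {r : ℕ × V → Bool} {m : V → Bool}
    (hr : ∀ q ∈ g.anc, r (j, q) = m q) (hr' : ∀ q ∉ g.anc, r (j, q) = 0) (m' : V → Bool)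
    (χ : QState Λ) :
    (g.restore j).apply r m' (measureBranch g.anc m (g.signedState χ)) =
      embedState g.data (g.amplitude • χ) := by
  simp only [Alternation.apply, restore, List.foldl_cons, List.foldl_nil, singleStep_some_apply,
    linearCircuit_eval, AddMonoidHom.add_apply, AddMonoidHom.id_apply,
    g.localMap_backGate hr', measureBranch_eq_indicator]
  funext x
  rw [Set.indicator_of_mem (by simp)]
  by_cases hx : ∀ q ∈ g.anc, x q = 0
  · rw [Set.indicator_of_mem, g.boolSign_mul_signedState hr' χ hx]
    intro q hq
    rw [Pi.add_apply, hx q hq, zero_add, hr q hq]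
  · rw [Set.indicator_of_notMem, mul_zero, embedState, Set.indicator_of_notMem]
    · refine mt (fun h q hq => h q ?_) hx
      rintro ⟨i, rfl⟩
      exact g.data_notMem_anc i hq
    · refine mt (fun h q hq => ?_) hx
      have := h q hq
      rwa [Pi.add_apply, hr q hq, add_eq_right] at this

theorem run_alternations [Fintype Λ] [DecidableEq Λ] [Fintype Θ]
    (U : Λ → Matrix.unitaryGroup Bool ℂ) (w : Θ → unitary ℂ) (o : ℕ → V → Bool) (j : ℕ)
    (r : ℕ × V → Bool) (rest : List (Alternation G)) (φ : QState Λ) :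
    ∃ r', Alternation.run o (g.alternations U w j ++ rest) j r (embedState g.data φ) =
      Alternation.run o rest (j + 3) r' (embedState g.data ((g.amplitude * g.amplitude) •
        fun z => parityPhase parity w z *
          localMap (fun i => (U i : Matrix Bool Bool ℂ)) φ z)) := by
  set r₁ := (g.couple U).record j (o j) r with hr₁
  set r₂ := (g.accumulate w j).record (j + 1) (o (j + 1)) r₁ with hr₂
  have couple_eq := g.couple_apply U r (c := fun q => r₁ (j, q)) (m := o j)
    (fun q hq => by simp [hr₁, Alternation.record, couple, hq])
    (fun q hq => by simp [hr₁, Alternation.record, couple, hq]; rfl) φ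
  have restore_eq := g.restore_apply (j + 1) (r := r₂) (m := o (j + 1))
    (fun q hq => by simp [hr₂, Alternation.record, accumulate, hq])
    (fun q hq => by simp [hr₂, Alternation.record, accumulate, hq]; rfl) (o (j + 2))
  refine ⟨(g.restore (j + 1)).record (j + 2) (o (j + 2)) r₂, ?_⟩
  simp only [alternations, List.cons_append, List.nil_append, Alternation.run, ← hr₁, ← hr₂,
    couple_eq, accumulate_apply, restore_eq]
  congr 2
  funext z
  simp only [Pi.smul_apply, smul_eq_mul]
  ring

end Semantics

end ParityGadget

/-! ### Parities on the grid -/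

section SubOne

variable {n : ℕ}

theorem succ_sub_one (i : Fin n) : i.succ - 1 = i.castSucc := by
  rw [← Fin.coeSucc_eq_succ, add_sub_cancel_right]

theorem eq_apply_zero_of_eq_sub_one {α : Type*} {f : Fin (n + 1) → α}
    (h : ∀ i ≠ 0, f i = f (i - 1)) (i : Fin (n + 1)) : f i = f 0 := by
  induction i using Fin.induction with
  | zero => rfl
  | succ i ih => rw [h _ i.succ_ne_zero, succ_sub_one, ih]

theorem sum_add_sub_one (f : Fin (n + 1) → Bool) :
    ∑ i, ((if i = 0 then 0 else f (i - 1)) + f i) = f (Fin.last n) := by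
  rw [Finset.sum_add_distrib, Fin.sum_univ_succ, Fin.sum_univ_castSucc f]
  simp only [if_true, Fin.succ_ne_zero, if_false, succ_sub_one, zero_add]
  rw [← add_assoc, BooleanRing.add_self, zero_add]

end SubOne

/-- The kinds of cells in a block of three rows and two columns. Block `(i, τ)` has a copy of data
bit `i`, and a partial sum `acc` of parity number `τ`. -/
inductive CellKind : Type
  | link | copy | check | acc | idle | spare
  deriving DecidableEq

namespace CellKind

/-- The position of a cell in its block. -/
def equiv : CellKind ≃ Fin 3 × Fin 2 where
  toFun
    | link => (0, 0)
    | copy => (0, 1)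
    | check => (1, 1)
    | acc => (2, 1)
    | idle => (1, 0)
    | spare => (2, 0)
  invFun
    | (0, 0) => link
    | (0, 1) => copy
    | (1, 1) => check
    | (2, 1) => acc
    | (1, 0) => idle
    | (2, 0) => spare
  left_inv := by rintro (_ | _) <;> rfl
  right_inv := by decide

/-- The pairing of ancillas with measured cells. -/
def partner : Equiv.Perm CellKind :=
  Equiv.swap link copy * Equiv.swap check acc

end CellKind

open CellKind

section Grid

variable {N T : ℕ}

/-- The qubits of a grid of `N + 1` by `T + 1` blocks. -/
abbrev GridQubit (N T : ℕ) : Type := Fin ((N + 1) * 3) × Fin ((T + 1) * 2)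

/-- The grid graph on the qubits of the blocks. -/
abbrev blockGrid (N T : ℕ) : SimpleGraph (GridQubit N T) := gridGraph ((N + 1) * 3) ((T + 1) * 2)

/-- The positions on the grid of the cells of the blocks. -/
def cell (N T : ℕ) : CellKind × Fin (N + 1) × Fin (T + 1) ≃ GridQubit N T :=
  (CellKind.equiv.prodCongr (Equiv.refl _)).trans <|
    ((Equiv.prodProdProdComm _ _ _ _).trans ((Equiv.prodComm _ _).prodCongr
      (Equiv.prodComm _ _))).trans (finProdFinEquiv.prodCongr finProdFinEquiv)

theorem cell_row (κ : CellKind) (b : Fin (N + 1) × Fin (T + 1)) :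
    ((cell N T (κ, b)).1 : ℕ) = (CellKind.equiv κ).1 + 3 * b.1 := rfl

theorem cell_col (κ : CellKind) (b : Fin (N + 1) × Fin (T + 1)) :
    ((cell N T (κ, b)).2 : ℕ) = (CellKind.equiv κ).2 + 2 * b.2 := rfl

theorem forall_gridQubit {p : GridQubit N T → Prop} :
    (∀ q, p q) ↔ ∀ κ i τ, p (cell N T (κ, i, τ)) := by
  rw [← (cell N T).forall_congr_right]
  simp only [Prod.forall]

theorem blockGrid_adj_iff (κ κ' : CellKind) (b b' : Fin (N + 1) × Fin (T + 1)) :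
    (blockGrid N T).Adj (cell N T (κ, b)) (cell N T (κ', b')) ↔
      let row := fun κ (b : Fin (N + 1) × Fin (T + 1)) => ((CellKind.equiv κ).1 + 3 * b.1 : ℕ)
      let col := fun κ (b : Fin (N + 1) × Fin (T + 1)) => ((CellKind.equiv κ).2 + 2 * b.2 : ℕ)
      ((row κ b + 1 = row κ' b' ∨ row κ' b' + 1 = row κ b) ∧ col κ b = col κ' b') ∨
      ((col κ b + 1 = col κ' b' ∨ col κ' b' + 1 = col κ b) ∧ row κ b = row κ' b') := by
  simp only [SimpleGraph.boxProd_adj, SimpleGraph.pathGraph_adj, Fin.ext_iff, cell_row, cell_col]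

theorem adj_copy_link (b : Fin (N + 1) × Fin (T + 1)) :
    (blockGrid N T).Adj (cell N T (copy, b)) (cell N T (link, b)) := by
  rw [blockGrid_adj_iff]
  simp [CellKind.equiv, add_comm]

theorem adj_acc_check (b : Fin (N + 1) × Fin (T + 1)) :
    (blockGrid N T).Adj (cell N T (acc, b)) (cell N T (check, b)) := by
  rw [blockGrid_adj_iff]
  simp [CellKind.equiv, add_right_comm]

theorem adj_copy_check (b : Fin (N + 1) × Fin (T + 1)) :
    (blockGrid N T).Adj (cell N T (copy, b)) (cell N T (check, b)) := by
  rw [blockGrid_adj_iff]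
  simp [CellKind.equiv, add_comm]

theorem adj_copy_link_of_ne_zero (b : Fin (N + 1) × Fin (T + 1)) (hb : b.2 ≠ 0) :
    (blockGrid N T).Adj (cell N T (copy, b.1, b.2 - 1)) (cell N T (link, b)) := by
  have pos := Fin.pos_iff_ne_zero.mpr hb
  rw [Fin.lt_def, Fin.val_zero] at pos
  rw [blockGrid_adj_iff]
  simp only [CellKind.equiv, Equiv.coe_fn_mk, Fin.val_sub_one_of_ne_zero hb]
  simp
  omega

theorem adj_acc_copy_of_ne_zero (b : Fin (N + 1) × Fin (T + 1)) (hb : b.1 ≠ 0) :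
    (blockGrid N T).Adj (cell N T (acc, b.1 - 1, b.2)) (cell N T (copy, b)) := by
  have pos := Fin.pos_iff_ne_zero.mpr hb
  rw [Fin.lt_def, Fin.val_zero] at pos
  rw [blockGrid_adj_iff]
  simp only [CellKind.equiv, Equiv.coe_fn_mk, Fin.val_sub_one_of_ne_zero hb]
  simp
  omega

/-- The CNOT gates which act on the cells of kind `κ` in the blocks satisfying `p`, each controlled
by the cell of kind `κ'` in the block given by `f`. -/
def cellPattern {κ κ' : CellKind} (kind_ne : κ' ≠ κ) (p : Fin (N + 1) × Fin (T + 1) → Prop)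
    [DecidablePred p] {f : Fin (N + 1) × Fin (T + 1) → Fin (N + 1) × Fin (T + 1)}
    (f_injective : Function.Injective f)
    (adj : ∀ b, p b → (blockGrid N T).Adj (cell N T (κ', f b)) (cell N T (κ, b))) :
    CnotPattern (blockGrid N T) where
  targets := {q | ((cell N T).symm q).1 = κ ∧ p ((cell N T).symm q).2}
  control q := cell N T (κ', f ((cell N T).symm q).2)
  adj q hq := by
    obtain ⟨rfl, hp⟩ := (Finset.mem_filter.mp hq).2
    simpa only [Prod.eta, Equiv.apply_symm_apply] using adj _ hp
  injOn q hq r hr h := by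
    have block_eq := f_injective (Prod.ext_iff.mp ((cell N T).injective h)).2
    have kind_eq := (Finset.mem_filter.mp hq).2.1.trans (Finset.mem_filter.mp hr).2.1.symm
    exact (cell N T).symm.injective (Prod.ext kind_eq block_eq)
  control_notMem q _ h := by
    have h' := (Finset.mem_filter.mp h).2.1
    rw [Equiv.symm_apply_apply] at h'
    exact kind_ne h'

theorem cellPattern_map_apply {κ κ' : CellKind} (kind_ne : κ' ≠ κ)
    {p : Fin (N + 1) × Fin (T + 1) → Prop} [DecidablePred p]
    {f : Fin (N + 1) × Fin (T + 1) → Fin (N + 1) × Fin (T + 1)}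
    (f_injective : Function.Injective f)
    (adj : ∀ b, p b → (blockGrid N T).Adj (cell N T (κ', f b)) (cell N T (κ, b)))
    (x : GridQubit N T → Bool) (μ : CellKind) (b : Fin (N + 1) × Fin (T + 1)) :
    (cellPattern kind_ne p f_injective adj).map x (cell N T (μ, b)) =
      if μ = κ ∧ p b then x (cell N T (μ, b)) + x (cell N T (κ', f b))
      else x (cell N T (μ, b)) := by
  split_ifs with h
  · rw [CnotPattern.map_of_mem _ (by simpa [cellPattern] using h)]
    simp [cellPattern]
  · rw [CnotPattern.map_of_notMem _ (by simpa [cellPattern] using h)]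

/-- The block one row up. -/
def rowPred (b : Fin (N + 1) × Fin (T + 1)) : Fin (N + 1) × Fin (T + 1) := (b.1 - 1, b.2)

/-- The block one column to the left. -/
def colPred (b : Fin (N + 1) × Fin (T + 1)) : Fin (N + 1) × Fin (T + 1) := (b.1, b.2 - 1)

theorem rowPred_injective : Function.Injective (rowPred (N := N) (T := T)) :=
  Function.Injective.prodMap (sub_left_injective (b := 1)) Function.injective_id

theorem colPred_injective : Function.Injective (colPred (N := N) (T := T)) :=
  Function.Injective.prodMap Function.injective_id (sub_left_injective (b := 1))

/-- The coupling of the blocks. Modulo two, `link` receives the difference of consecutive copies of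
a data bit, and `check` the difference of consecutive partial sums of the parity of the data bits
`i` with `S τ i`. -/
def gridPatterns (S : Fin (T + 1) → Fin (N + 1) → Bool) : List (CnotPattern (blockGrid N T)) :=
  let accToCopy := cellPattern (κ := copy) (κ' := acc) nofun (fun b => b.1 ≠ 0) rowPred_injective
    adj_acc_copy_of_ne_zero
  [cellPattern (κ := link) (κ' := copy) nofun (fun b => b.2 ≠ 0) Function.injective_id
      fun b _ => adj_copy_link b,
    cellPattern (κ := link) (κ' := copy) nofun (fun b => b.2 ≠ 0) colPred_injective
      adj_copy_link_of_ne_zero,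
    cellPattern (κ := check) (κ' := acc) nofun (fun _ => True) Function.injective_id
      fun b _ => adj_acc_check b,
    cellPattern (κ := check) (κ' := copy) nofun (fun b => S b.2 b.1 = false) Function.injective_id
      fun b _ => adj_copy_check b,
    -- `acc` is not adjacent to the `check` below it, so that the partial sum passes through `copy`
    accToCopy,
    cellPattern (κ := check) (κ' := copy) nofun (fun _ => True) Function.injective_id
      fun b _ => adj_copy_check b,
    accToCopy]

/-- The action of the coupling on basis states. -/
def gridEffect (S : Fin (T + 1) → Fin (N + 1) → Bool) :
    (GridQubit N T → Bool) →+ (GridQubit N T → Bool) :=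
  CnotPattern.listMap (gridPatterns S)

section GridEffect

variable (S : Fin (T + 1) → Fin (N + 1) → Bool) (x : GridQubit N T → Bool)
  (i : Fin (N + 1)) (τ : Fin (T + 1))

theorem gridEffect_link : gridEffect S x (cell N T (link, i, τ)) = x (cell N T (link, i, τ)) +
    if τ = 0 then 0 else x (cell N T (copy, i, τ - 1)) + x (cell N T (copy, i, τ)) := by
  obtain rfl | hτ := eq_or_ne τ 0 <;> obtain rfl | hi := eq_or_ne i 0 <;>
  simp [gridEffect, CnotPattern.listMap, gridPatterns, cellPattern_map_apply, colPred, *,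
    add_assoc, BooleanRing.add_self]

theorem gridEffect_check : gridEffect S x (cell N T (check, i, τ)) = x (cell N T (check, i, τ)) +
    (S τ i * x (cell N T (copy, i, τ)) + ((if i = 0 then 0 else x (cell N T (acc, i - 1, τ))) +
      x (cell N T (acc, i, τ)))) := by
  have add_self_add (a b : Bool) : a + (a + b) = b := by
    rw [← add_assoc, BooleanRing.add_self, zero_add]
  have add_add_self_add (a b c : Bool) : a + (b + (a + c)) = b + c := by
    rw [add_left_comm b, add_self_add]
  obtain rfl | hi := eq_or_ne i 0 <;> cases hS : S τ _ <;>
  simp [gridEffect, CnotPattern.listMap, gridPatterns, cellPattern_map_apply, rowPred, *,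
    Bool.mul_eq_and, add_assoc, show (0 : Bool) = false from rfl]

end GridEffect

/-- The cells which hold neither data nor check values: the further copies of the data bits, and the
partial sums. -/
def gridAnc (N T : ℕ) : Finset (GridQubit N T) :=
  {q | ((cell N T).symm q).1 = acc ∨ ((cell N T).symm q).1 = copy ∧ ((cell N T).symm q).2.2 ≠ 0}

/-- The cells which receive the differences. -/
def gridMeas (N T : ℕ) : Finset (GridQubit N T) :=
  {q | ((cell N T).symm q).1 = check ∨ ((cell N T).symm q).1 = link ∧ ((cell N T).symm q).2.2 ≠ 0}

theorem cell_mem_gridAnc {κ : CellKind} {i : Fin (N + 1)} {τ : Fin (T + 1)} :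
    cell N T (κ, i, τ) ∈ gridAnc N T ↔ κ = acc ∨ κ = copy ∧ τ ≠ 0 := by
  simp [gridAnc]

theorem cell_mem_gridMeas {κ : CellKind} {i : Fin (N + 1)} {τ : Fin (T + 1)} :
    cell N T (κ, i, τ) ∈ gridMeas N T ↔ κ = check ∨ κ = link ∧ τ ≠ 0 := by
  simp [gridMeas]

theorem card_gridAnc : (gridAnc N T).card = (gridMeas N T).card := by
  refine Finset.card_equiv ((cell N T).symm.trans
    ((CellKind.partner.prodCongr (Equiv.refl _)).trans (cell N T))) ?_
  rw [forall_gridQubit]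
  rintro (_ | _) i τ <;>
  simp [cell_mem_gridAnc, cell_mem_gridMeas, CellKind.partner, Equiv.swap_apply_def]

theorem disjoint_gridAnc_gridMeas : Disjoint (gridAnc N T) (gridMeas N T) := by
  rw [Finset.disjoint_left, forall_gridQubit]
  rintro (_ | _) i τ <;> simp [cell_mem_gridAnc, cell_mem_gridMeas]

theorem gridEffect_of_notMem (S : Fin (T + 1) → Fin (N + 1) → Bool) (x : GridQubit N T → Bool)
    {q : GridQubit N T} (hq : q ∉ gridMeas N T) : gridEffect S x q = x q := by
  revert q
  rw [forall_gridQubit]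
  intro κ i τ h
  rw [cell_mem_gridMeas] at h
  obtain rfl | hi := eq_or_ne i 0 <;> cases κ <;>
  simp_all [gridEffect, CnotPattern.listMap, gridPatterns, cellPattern_map_apply, rowPred,
    add_assoc, BooleanRing.add_self]

section ZeroOnMeas

variable {S : Fin (T + 1) → Fin (N + 1) → Bool} {x : GridQubit N T → Bool}
  (effect_eq_zero : ∀ q ∈ gridMeas N T, gridEffect S x q = 0)

include effect_eq_zero

theorem copy_eq_copy_zero (eq_zero : ∀ q ∈ gridMeas N T, x q = 0) (i : Fin (N + 1))
    (τ : Fin (T + 1)) : x (cell N T (copy, i, τ)) = x (cell N T (copy, i, 0)) := by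
  refine eq_apply_zero_of_eq_sub_one (f := fun τ => x (cell N T (copy, i, τ))) (fun τ hτ => ?_) τ
  have mem_meas := cell_mem_gridMeas (i := i).mpr (.inr ⟨rfl, hτ⟩)
  have sum_eq_zero := effect_eq_zero _ mem_meas
  rw [gridEffect_link, eq_zero _ mem_meas, zero_add, if_neg hτ] at sum_eq_zero
  exact ((BooleanRing.add_eq_zero' _ _).mp sum_eq_zero).symm

theorem add_acc_eq (eq_zero : ∀ q ∈ gridMeas N T, x q = 0) (i : Fin (N + 1)) (τ : Fin (T + 1)) :
    (if i = 0 then 0 else x (cell N T (acc, i - 1, τ))) + x (cell N T (acc, i, τ)) =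
      S τ i * x (cell N T (copy, i, 0)) := by
  have mem_meas := cell_mem_gridMeas (i := i) (τ := τ).mpr (.inl rfl)
  have sum_eq_zero := effect_eq_zero _ mem_meas
  rw [gridEffect_check, eq_zero _ mem_meas, zero_add,
    copy_eq_copy_zero effect_eq_zero eq_zero] at sum_eq_zero
  exact ((BooleanRing.add_eq_zero' _ _).mp sum_eq_zero).symm

theorem acc_last_eq_sum (eq_zero : ∀ q ∈ gridMeas N T, x q = 0) (τ : Fin (T + 1)) :
    x (cell N T (acc, Fin.last N, τ)) = ∑ i, S τ i * x (cell N T (copy, i, 0)) := by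
  rw [← sum_add_sub_one fun i => x (cell N T (acc, i, τ))]
  exact Finset.sum_congr rfl fun i _ => add_acc_eq effect_eq_zero eq_zero i τ

theorem eq_zero_of_gridEffect (eq_zero : ∀ q ∉ gridAnc N T, x q = 0) : x = 0 := by
  have meas_eq_zero : ∀ q ∈ gridMeas N T, x q = 0 := fun q hq =>
    eq_zero q (Finset.disjoint_right.mp disjoint_gridAnc_gridMeas hq)
  have data_eq_zero : ∀ i, x (cell N T (copy, i, 0)) = 0 := fun i =>
    eq_zero _ (by simp [cell_mem_gridAnc])
  have add_acc_eq_zero : ∀ i τ, _ = _ := fun i τ =>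
    (add_acc_eq effect_eq_zero meas_eq_zero i τ).trans (by rw [data_eq_zero, mul_zero])
  have acc_eq_zero : ∀ i τ, x (cell N T (acc, i, τ)) = 0 := fun i τ => by
    rw [eq_apply_zero_of_eq_sub_one (f := fun i => x (cell N T (acc, i, τ)))
      (fun i hi => by
        have sum_eq_zero := add_acc_eq_zero i τ
        rw [if_neg hi, BooleanRing.add_eq_zero'] at sum_eq_zero
        exact sum_eq_zero.symm) i]
    simpa only [if_true, zero_add] using add_acc_eq_zero 0 τ
  have apply_eq_zero : ∀ q, x q = 0 := by
    rw [forall_gridQubit]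
    intro κ i τ
    by_cases h : cell N T (κ, i, τ) ∈ gridAnc N T
    · obtain rfl | ⟨rfl, -⟩ := cell_mem_gridAnc.mp h
      · exact acc_eq_zero i τ
      · rw [copy_eq_copy_zero effect_eq_zero meas_eq_zero, data_eq_zero]
    · exact eq_zero _ h
  exact funext apply_eq_zero

end ZeroOnMeas

section GridGadget

variable {Λ Θ : Type} (e : Λ ≃ Fin (N + 1)) (f : Θ ≃ Fin (T + 1))

/-- The positions of the data bits: the first copies. -/
@[simps]
def dataCell (T : ℕ) : Λ ↪ GridQubit N T where
  toFun i := cell N T (copy, e i, 0)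
  inj' i j h := by simpa using h

/-- The positions of the parities: the last partial sums. -/
@[simps]
def parityCell (N : ℕ) : Θ ↪ GridQubit N T where
  toFun θ := cell N T (acc, Fin.last N, f θ)
  inj' θ θ' h := by simpa using h

variable [DecidableEq Λ] (parity : (Λ → Bool) →+ (Θ → Bool))

/-- Whether parity number `τ` contains data bit number `i`. -/
def parityMatrix (τ : Fin (T + 1)) (i : Fin (N + 1)) : Bool :=
  parity (Pi.single (e.symm i) 1) (f.symm τ)

theorem apply_parityCell {x : GridQubit N T → Bool} (eq_zero : ∀ q ∈ gridMeas N T, x q = 0)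
    (effect_eq_zero : ∀ q ∈ gridMeas N T, gridEffect (parityMatrix e f parity) x q = 0) (θ : Θ) :
    x (parityCell f N θ) = parity (fun i => x (dataCell e T i)) θ := by
  have := Fintype.ofEquiv _ e.symm
  rw [parityCell_apply, acc_last_eq_sum effect_eq_zero eq_zero, addMonoidHom_apply_eq_sum,
    ← e.sum_comp]
  simp only [parityMatrix, Equiv.symm_apply_apply, dataCell_apply]

/-- The computation of parities of data bits on a grid. -/
noncomputable def gridGadget [Fintype Λ] : ParityGadget (blockGrid N T) parity where
  data := dataCell e T
  anc := gridAnc N T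
  meas := gridMeas N T
  steps := (gridPatterns (parityMatrix e f parity)).map fun P => P.step _
  effect := gridEffect (parityMatrix e f parity)
  steps_apply y ψ := CnotPattern.foldl_step_apply y _ ψ
  effect_of_notMem _ _ hq := gridEffect_of_notMem _ _ hq
  data_notMem_anc _ := by simp [cell_mem_gridAnc]
  data_notMem_meas _ := by simp [cell_mem_gridMeas]
  disjoint := disjoint_gridAnc_gridMeas
  card_eq := card_gridAnc
  eq_zero _ h h' := eq_zero_of_gridEffect h' h
  acc := parityCell f N
  apply_acc _ h h' := apply_parityCell e f parity h h'

end GridGadget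

end Grid

/-! ### Circuits of single-qubit gates and cubic phases without locality constraints -/

/-- Single-qubit gates, followed by the sign `(-1) ^ ∑ z a * z b * z c`, where the sum extends over
the triples `(a, b, c)` in `cubic`. -/
structure CubicLayer (Λ : Type) : Type where
  gate : Λ → Matrix.unitaryGroup Bool ℂ
  cubic : Λ × Λ × Λ → Bool

section CubicForm

variable {Λ : Type} [Fintype Λ]

/-- The cubic form over `𝔽₂` with the given coefficients, as a function on bit strings. -/
def cubicForm : (Λ × Λ × Λ → Bool) →+ ((Λ → Bool) → Bool) where
  toFun E z := ∑ p, E p * (z p.1 * z p.2.1 * z p.2.2)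
  map_zero' := by
    funext z
    simp only [Pi.zero_apply, zero_mul, Finset.sum_const_zero]
  map_add' E F := by
    funext z
    simp only [Pi.add_apply, add_mul, Finset.sum_add_distrib]

theorem cubicForm_single [DecidableEq Λ] (a b c : Λ) (k : Bool) (z : Λ → Bool) :
    cubicForm (Pi.single (a, b, c) k) z = k * (z a * z b * z c) := by
  refine (Finset.sum_eq_single (a, b, c) (fun p _ hp => ?_) (by simp)).trans ?_
  · rw [Pi.single_eq_of_ne hp, zero_mul]
  · rw [Pi.single_eq_same]

end CubicForm

namespace CubicLayer

variable {Λ : Type} [Fintype Λ] [DecidableEq Λ]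

/-- The action of a layer on states. -/
def apply (l : CubicLayer Λ) (φ : QState Λ) : QState Λ :=
  fun z => boolSign (cubicForm l.cubic z) *
    localMap (fun i => (l.gate i : Matrix Bool Bool ℂ)) φ z

/-- The action of a sequence of layers on states. -/
def run (ls : List (CubicLayer Λ)) (φ : QState Λ) : QState Λ :=
  ls.foldl (fun φ l => l.apply φ) φ

theorem apply_smul (l : CubicLayer Λ) (c : ℂ) (φ : QState Λ) :
    l.apply (c • φ) = c • l.apply φ := by
  funext z
  simp only [apply, localMap_smul, Pi.smul_apply, smul_eq_mul, mul_left_comm]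

theorem run_cons (l : CubicLayer Λ) (ls : List (CubicLayer Λ)) (φ : QState Λ) :
    run (l :: ls) φ = run ls (l.apply φ) := rfl

theorem run_append (ls ls' : List (CubicLayer Λ)) (φ : QState Λ) :
    run (ls ++ ls') φ = run ls' (run ls φ) := List.foldl_append

theorem run_smul (c : ℂ) (ls : List (CubicLayer Λ)) (φ : QState Λ) :
    run ls (c • φ) = c • run ls φ := by
  induction ls generalizing φ with
  | nil => rfl
  | cons l ls ih => rw [run_cons, apply_smul, ih, run_cons]

end CubicLayer

/-! ### Cubic phases from phases of parities -/

/-- The parities from which the sign of a triple is composed: the sums over its subsets. -/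
def tripleParity (Λ : Type) : (Λ → Bool) →+ ((Λ × Λ × Λ) × Bool × Bool × Bool → Bool) where
  toFun z θ := θ.2.1 * z θ.1.1 + θ.2.2.1 * z θ.1.2.1 + θ.2.2.2 * z θ.1.2.2
  map_zero' := by
    funext θ
    simp only [Pi.zero_apply, mul_zero, add_zero]
  map_add' z z' := by
    funext θ
    simp only [Pi.add_apply]
    ring

/-- A primitive eighth root of unity. -/
noncomputable def eighthRoot : unitary ℂ :=
  ⟨rootHalf * (1 + Complex.I), by
    have conj_rootHalf : (starRingEnd ℂ) rootHalf = rootHalf := Complex.conj_ofReal _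
    rw [Unitary.mem_iff_self_mul_star]
    simp only [star_mul', star_add, star_one, Complex.star_def, Complex.conj_I, conj_rootHalf]
    linear_combination (1 + Complex.I) * (1 - Complex.I) * rootHalf_mul_self -
      1 / 2 * Complex.I_mul_I⟩

theorem eighthRoot_pow_four : (eighthRoot : ℂ) ^ 4 = -1 := by
  change (rootHalf * (1 + Complex.I)) ^ 4 = -1
  have one_add_I_pow : (1 + Complex.I) ^ 4 = -4 := by
    linear_combination (Complex.I ^ 2 + 4 * Complex.I + 5) * Complex.I_mul_I
  have rootHalf_pow : rootHalf ^ 4 = 1 / 4 := by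
    linear_combination (rootHalf * rootHalf + 1 / 2) * rootHalf_mul_self
  rw [mul_pow, one_add_I_pow, rootHalf_pow]
  norm_num

/-- The phases of the parities of a triple: `ζ` for subsets of odd and `ζ⁻¹` for nonempty subsets
of even size, where `ζ` is the primitive eighth root of unity. -/
noncomputable def maskPhase (μ : Bool × Bool × Bool) : unitary ℂ :=
  if μ = (false, false, false) then 1
  else if μ.1 + μ.2.1 + μ.2.2 then eighthRoot else star eighthRoot

-- For bits, `4 x y z = x + y + z - (x ⊕ y) - (x ⊕ z) - (y ⊕ z) + (x ⊕ y ⊕ z)`, and `ζ ^ 4 = -1`.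
theorem prod_maskPhase (x y z : Bool) :
    (∏ μ : Bool × Bool × Bool, if μ.1 * x + μ.2.1 * y + μ.2.2 * z
      then (maskPhase μ : ℂ) else 1) = boolSign (x * y * z) := by
  have mul_conj : (eighthRoot : ℂ) * (starRingEnd ℂ) (eighthRoot : ℂ) = 1 :=
    Unitary.mul_star_self_of_mem eighthRoot.2
  simp only [Fintype.prod_prod_type, Fintype.prod_bool, maskPhase, Bool.mul_eq_and,
    Bool.add_eq_xor, Prod.mk.injEq]
  cases x <;> cases y <;> cases z <;>
    simp only [Bool.and_self, Bool.and_false, Bool.and_true, Bool.bne_true, Bool.bne_false,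
      bne_self_eq_false, Bool.not_false, Bool.false_eq_true, Bool.true_eq_false, and_self,
      and_true, and_false, ↓reduceIte, one_mul, mul_one, boolSign_false,
      boolSign_true, Unitary.coe_star, Complex.star_def]
  all_goals first
    | rfl
    | linear_combination eighthRoot_pow_four
    | linear_combination (eighthRoot * (starRingEnd ℂ) eighthRoot + 1 : ℂ) * mul_conj

section CubicPhase

variable {Λ : Type}

/-- The phases of the parities for the cubic form with coefficients `E`. -/
noncomputable def cubicPhase (E : Λ × Λ × Λ → Bool) (θ : (Λ × Λ × Λ) × Bool × Bool × Bool) :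
    unitary ℂ :=
  if E θ.1 then maskPhase θ.2 else 1

theorem parityPhase_tripleParity [Fintype Λ] (E : Λ × Λ × Λ → Bool) (z : Λ → Bool) :
    parityPhase (tripleParity Λ) (cubicPhase E) z = boolSign (cubicForm E z) := by
  rw [parityPhase, Fintype.prod_prod_type]
  refine Eq.trans (Finset.prod_congr rfl fun p _ => ?_) (boolSign_sum _ _).symm
  cases hE : E p
  · rw [show (false : Bool) = 0 from rfl, zero_mul, boolSign_zero]
    exact Finset.prod_eq_one fun μ _ => by simp [cubicPhase, hE]
  · rw [show (true : Bool) = 1 from rfl, one_mul, ← prod_maskPhase]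
    refine Finset.prod_congr rfl fun μ _ => ?_
    rw [cubicPhase, if_pos hE]
    rfl

end CubicPhase

/-! ### Compilation of cubic layers -/

section EmbedState

variable {V Λ : Type} (data : Λ ↪ V)

theorem zeroState_eq_embedState : zeroState V = embedState data (zeroState Λ) := by
  classical
  funext x
  simp only [zeroState, embedState, Set.indicator_apply, Set.mem_ofPred_eq, ← ite_and]
  refine if_congr ⟨fun h => ⟨fun q _ => h q, fun i => h (data i)⟩, fun ⟨h, h'⟩ q => ?_⟩ rfl rfl
  by_cases hq : q ∈ Set.range data
  · obtain ⟨i, rfl⟩ := hq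
    exact h' i
  · exact h q hq

theorem embedState_withAncillas {n : ℕ} (out : Fin n ↪ Λ) (ψ : QState (Fin n)) :
    embedState data (withAncillas out ψ) = withAncillas (out.trans data) ψ := by
  classical
  funext x
  simp only [embedState, withAncillas, Set.indicator_apply, Set.mem_ofPred_eq, ← ite_and]
  refine if_congr ⟨fun ⟨h, h'⟩ q hq => ?_, fun h => ⟨fun q hq => h q ?_, fun i hi => h _ ?_⟩⟩
    rfl rfl
  · by_cases hq' : q ∈ Set.range data
    · obtain ⟨i, rfl⟩ := hq'
      exact h' i fun ⟨k, hk⟩ => hq ⟨k, congrArg data hk⟩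
    · exact h q hq'
  · rintro ⟨k, rfl⟩
    exact hq ⟨out k, rfl⟩
  · rintro ⟨k, hk⟩
    exact hi ⟨k, data.injective hk⟩

end EmbedState

section Compile

variable {Λ V : Type} [Fintype V] [DecidableEq V] {G : SimpleGraph V}
  (g : ParityGadget G (tripleParity Λ))

/-- The alternations which perform a sequence of layers, starting with alternation number `j`. -/
noncomputable def compileLayers : List (CubicLayer Λ) → ℕ → List (Alternation G)
  | [], _ => []
  | l :: ls, j => g.alternations l.gate (cubicPhase l.cubic) j ++ compileLayers ls (j + 3)

theorem length_compileLayers (ls : List (CubicLayer Λ)) (j : ℕ) :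
    (compileLayers g ls j).length = 3 * ls.length := by
  induction ls generalizing j with
  | nil => rfl
  | cons l ls ih =>
    rw [compileLayers, List.length_append, ih, List.length_cons, mul_add, add_comm]
    rfl

theorem exists_mem_alternations_of_mem_compileLayers {ls : List (CubicLayer Λ)} {j : ℕ}
    {A : Alternation G} (hA : A ∈ compileLayers g ls j) : ∃ U w j', A ∈ g.alternations U w j' := by
  induction ls generalizing j with
  | nil => exact absurd hA List.not_mem_nil
  | cons l ls ih => exact (List.mem_append.mp hA).elim (fun h => ⟨_, _, _, h⟩) ih

variable [Fintype Λ] [DecidableEq Λ]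

theorem run_compileLayers (o : ℕ → V → Bool) (ls : List (CubicLayer Λ)) (j : ℕ)
    (r : ℕ × V → Bool) (φ : QState Λ) : ∃ c : ℂ,
    Alternation.run o (compileLayers g ls j) j r (embedState g.data φ) =
      c • embedState g.data (CubicLayer.run ls φ) := by
  induction ls generalizing j r φ with
  | nil => exact ⟨1, (one_smul _ _).symm⟩
  | cons l ls ih =>
    obtain ⟨r', hr⟩ := g.run_alternations l.gate (cubicPhase l.cubic) o
      j r (compileLayers g ls (j + 3)) φ
    simp only [parityPhase_tripleParity] at hr
    obtain ⟨c, hc⟩ := ih (j + 3) r' ((g.amplitude * g.amplitude) • l.apply φ)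
    refine ⟨c * (g.amplitude * g.amplitude), ?_⟩
    rw [compileLayers, hr, CubicLayer.run_cons]
    refine hc.trans ?_
    rw [CubicLayer.run_smul, embedState_smul, smul_smul]

theorem prepares_compileLayers {n : ℕ} (out : Fin n ↪ Λ) (ψ : QState (Fin n))
    (ls : List (CubicLayer Λ)) (h : CubicLayer.run ls (zeroState Λ) = withAncillas out ψ) :
    Prepares (compileLayers g ls 0) ψ := by
  refine ⟨out.trans g.data, fun o => ?_⟩
  obtain ⟨c, hc⟩ := run_compileLayers g o ls 0 (fun _ => false) (zeroState Λ)
  refine ⟨c, fun x => ?_⟩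
  rw [finalState, zeroState_eq_embedState g.data, hc, h, embedState_withAncillas, Pi.smul_apply,
    smul_eq_mul]

end Compile

theorem ParityGadget.bounds_of_mem_alternations {V : Type} [Fintype V] [DecidableEq V]
    {G : SimpleGraph V} {Λ Θ : Type} {parity : (Λ → Bool) →+ (Θ → Bool)}
    (g : ParityGadget G parity) {U : Λ → Matrix.unitaryGroup Bool ℂ} {w : Θ → unitary ℂ} {j : ℕ}
    {A : Alternation G} (hA : A ∈ g.alternations U w j) :
    A.quantum.length ≤ g.steps.length + 3 ∧
    A.conventional.depth ≤ 3 * Nat.clog 2 (Fintype.card V) + 1 ∧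
    A.conventional.size ≤ 6 * (Fintype.card V * 2 ^ Nat.clog 2 (Fintype.card V)) := by
  simp only [ParityGadget.alternations, List.mem_cons, List.not_mem_nil, or_false] at hA
  obtain rfl | rfl | rfl := hA
  · exact ⟨Nat.succ_le_succ (Nat.le_add_right _ 2), Nat.zero_le _, Nat.zero_le _⟩
  · exact ⟨Nat.le_add_left 3 _, (linearCircuit_depth (V := V) _ _).le,
      linearCircuit_size_le (V := V) _ _⟩
  · exact ⟨(Nat.le_add_left 1 2).trans (Nat.le_add_left 3 _), (linearCircuit_depth (V := V) _ _).le,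
      linearCircuit_size_le (V := V) _ _⟩

theorem two_pow_clog_le {m : ℕ} (hm : 0 < m) : 2 ^ Nat.clog 2 m ≤ 2 * m := by
  obtain rfl | h := Nat.eq_or_lt_of_le (Nat.succ_le_of_lt hm)
  · simp
  · have := Nat.pow_pred_clog_lt_self one_lt_two h
    rw [← Nat.succ_pred_eq_of_pos (Nat.clog_pos one_lt_two h), pow_succ]
    omega

theorem exists_laqCircuit (Λ : Type) [Fintype Λ] [DecidableEq Λ] [Nonempty Λ]
    (ls : List (CubicLayer Λ)) : ∃ C : LAQCircuit,
    C.numQubits = 48 * Fintype.card Λ ^ 4 ∧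
    C.alternations.length = 3 * ls.length ∧
    (∀ A ∈ C.alternations, A.quantum.length ≤ 10 ∧
      A.conventional.depth ≤ 3 * Nat.clog 2 (48 * Fintype.card Λ ^ 4) + 1 ∧
      A.conventional.size ≤ 12 * (48 * Fintype.card Λ ^ 4) ^ 2) ∧
    ∀ {n : ℕ} (out : Fin n ↪ Λ) (ψ : QState (Fin n)),
      CubicLayer.run ls (zeroState Λ) = withAncillas out ψ → Prepares C.alternations ψ := by
  obtain ⟨N, hN⟩ := Nat.exists_eq_succ_of_ne_zero (Fintype.card_ne_zero (α := Λ))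
  obtain ⟨T, hT⟩ := Nat.exists_eq_succ_of_ne_zero
    (Fintype.card_ne_zero (α := (Λ × Λ × Λ) × Bool × Bool × Bool))
  let g := gridGadget (Fintype.equivFinOfCardEq hN) (Fintype.equivFinOfCardEq hT) (tripleParity Λ)
  have qubits_eq : ((N + 1) * 3) * ((T + 1) * 2) = 48 * Fintype.card Λ ^ 4 := by
    rw [← Nat.succ_eq_add_one, ← Nat.succ_eq_add_one, ← hN, ← hT]
    simp only [Fintype.card_prod, Fintype.card_bool]
    ring
  refine ⟨⟨_, _, compileLayers g ls 0⟩, qubits_eq, length_compileLayers g ls 0, fun A hA => ?_,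
    fun out ψ => prepares_compileLayers g out ψ ls⟩
  obtain ⟨U, w, j, hA⟩ := exists_mem_alternations_of_mem_compileLayers g hA
  obtain ⟨quantum_le, depth_le, size_le⟩ := g.bounds_of_mem_alternations hA
  rw [Fintype.card_prod, Fintype.card_fin, Fintype.card_fin, qubits_eq] at depth_le size_le
  have qubits_pos : 0 < 48 * Fintype.card Λ ^ 4 := by positivity
  refine ⟨quantum_le, depth_le, size_le.trans ?_⟩
  calc
    _ ≤ 6 * (48 * Fintype.card Λ ^ 4 * (2 * (48 * Fintype.card Λ ^ 4))) := by
      gcongr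
      exact two_pow_clog_le qubits_pos
    _ = _ := by ring

/-! ### Quadratic maps on basis states -/

/-- The addition of quadratic polynomials in other qubits to the qubits `target k`. -/
structure QuadStep (Λ : Type) : Type 1 where
  {ι R : Type}
  [fintypeι : Fintype ι]
  [decidableEqι : DecidableEq ι]
  [fintypeR : Fintype R]
  target : ι ↪ Λ
  const : ι → Bool
  coef : ι → R → Bool
  left : ι → R → Λ
  right : ι → R → Λ
  left_notMem : ∀ k r, left k r ∉ Set.range target
  right_notMem : ∀ k r, right k r ∉ Set.range target

namespace QuadStep

attribute [instance] fintypeι decidableEqι fintypeR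

section Map

variable {Λ : Type} (s : QuadStep Λ)

/-- The polynomial which is added to the qubit `target k`. -/
def poly (k : s.ι) (z : Λ → Bool) : Bool :=
  s.const k + ∑ r, s.coef k r * (z (s.left k r) * z (s.right k r))

/-- The map on basis states. -/
noncomputable def map (z : Λ → Bool) : Λ → Bool :=
  Function.extend s.target (fun k => z (s.target k) + s.poly k z) z

theorem map_target (z : Λ → Bool) (k : s.ι) :
    s.map z (s.target k) = z (s.target k) + s.poly k z :=
  s.target.injective.extend_apply _ _ k

theorem map_of_notMem (z : Λ → Bool) {q : Λ} (hq : q ∉ Set.range s.target) : s.map z q = z q :=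
  Function.extend_apply' _ _ _ hq

theorem map_comp_of_notMem {K : Type*} (z : Λ → Bool) {e : K → Λ}
    (he : ∀ k, e k ∉ Set.range s.target) : s.map z ∘ e = z ∘ e :=
  funext fun k => s.map_of_notMem z (he k)

theorem poly_congr {z z' : Λ → Bool} (h : ∀ q ∉ Set.range s.target, z q = z' q) (k : s.ι) :
    s.poly k z = s.poly k z' := by
  simp only [poly, h _ (s.left_notMem k _), h _ (s.right_notMem k _)]

theorem map_map (z : Λ → Bool) : s.map (s.map z) = z := by
  funext q
  by_cases hq : q ∈ Set.range s.target
  · obtain ⟨k, rfl⟩ := hq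
    rw [map_target, map_target, s.poly_congr fun q hq => s.map_of_notMem z hq, add_assoc,
      BooleanRing.add_self, add_zero]
  · rw [map_of_notMem _ _ hq, map_of_notMem _ _ hq]

/-- The composition of the maps of a sequence of steps, the last one being applied first. -/
noncomputable def mapAll (ss : List (QuadStep Λ)) (z : Λ → Bool) : Λ → Bool :=
  ss.foldr map z

theorem mapAll_append (ss ss' : List (QuadStep Λ)) (z : Λ → Bool) :
    mapAll (ss ++ ss') z = mapAll ss (mapAll ss' z) := List.foldr_append

theorem mapAll_mapAll_reverse (ss : List (QuadStep Λ)) (z : Λ → Bool) :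
    mapAll ss (mapAll ss.reverse z) = z := by
  induction ss generalizing z with
  | nil => rfl
  | cons s ss ih =>
    rw [List.reverse_cons, mapAll_append]
    exact (congrArg s.map (ih _)).trans (s.map_map z)

end Map

section Constructors

variable {Λ ι : Type} [Fintype ι] [DecidableEq ι] (target : ι ↪ Λ)

/-- The addition of the dot product of two rows of qubits to each target. -/
abbrev dot {R : Type} [Fintype R] (left right : ι → R → Λ)
    (left_notMem : ∀ k r, left k r ∉ Set.range target)
    (right_notMem : ∀ k r, right k r ∉ Set.range target) : QuadStep Λ where
  target := target
  const _ := 0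
  coef _ _ := 1
  left := left
  right := right
  left_notMem := left_notMem
  right_notMem := right_notMem

theorem poly_dot {R : Type} [Fintype R] {left right : ι → R → Λ}
    (left_notMem : ∀ k r, left k r ∉ Set.range target)
    (right_notMem : ∀ k r, right k r ∉ Set.range target) (k : ι) (z : Λ → Bool) :
    (dot target left right left_notMem right_notMem).poly k z =
      ∑ r, z (left k r) * z (right k r) := by
  simp only [poly, zero_add, one_mul]

theorem dot_map_target {R : Type} [Fintype R] {left right : ι → R → Λ}
    (left_notMem : ∀ k r, left k r ∉ Set.range target)
    (right_notMem : ∀ k r, right k r ∉ Set.range target) (z : Λ → Bool) (k : ι) :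
    (dot target left right left_notMem right_notMem).map z (target k) =
      z (target k) + ∑ r, z (left k r) * z (right k r) :=
  (map_target _ z k).trans (congrArg _ (poly_dot ..))

/-- The addition of one qubit to each target. -/
abbrev add (source : ι → Λ) (source_notMem : ∀ k, source k ∉ Set.range target) : QuadStep Λ :=
  dot (R := Unit) target (fun k _ => source k) (fun k _ => source k) (fun k _ => source_notMem k)
    fun k _ => source_notMem k

theorem poly_add {source : ι → Λ} (source_notMem : ∀ k, source k ∉ Set.range target) (k : ι)
    (z : Λ → Bool) : (add target source source_notMem).poly k z = z (source k) := by
  rw [poly_dot, Fintype.sum_unique, BooleanRing.mul_self]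

theorem add_map_target {source : ι → Λ} (source_notMem : ∀ k, source k ∉ Set.range target)
    (z : Λ → Bool) (k : ι) :
    (add target source source_notMem).map z (target k) = z (target k) + z (source k) :=
  (map_target _ z k).trans (congrArg _ (poly_add ..))

end Constructors

section Sandwich

variable {Λ : Type} [DecidableEq Λ] (s : QuadStep Λ)

/-- The triples of qubits whose cubic phases give the quadratic map in the Hadamard basis. -/
def cubic : Λ × Λ × Λ → Bool :=
  ∑ k, (Pi.single (s.target k, s.target k, s.target k) (s.const k) +
    ∑ r, Pi.single (s.target k, s.left k r, s.right k r) (s.coef k r))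

/-- The cubic phases of the step between the gates `U` and `U'` on the targets. -/
noncomputable def sandwich (U U' : s.ι → Matrix.unitaryGroup Bool ℂ) : List (CubicLayer Λ) :=
  [⟨Function.extend s.target U 1, s.cubic⟩, ⟨Function.extend s.target U' 1, 0⟩]

/-- The layers which perform the quadratic map. -/
noncomputable def layers : List (CubicLayer Λ) :=
  s.sandwich (fun _ => ⟨hadamard, hadamard_mem⟩) fun _ => ⟨hadamard, hadamard_mem⟩

/-- The layers of a sequence of steps. -/
noncomputable def program (ss : List (QuadStep Λ)) : List (CubicLayer Λ) := ss.flatMap layers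

theorem length_program (ss : List (QuadStep Λ)) : (program ss).length = 2 * ss.length := by
  simp [program, layers, sandwich, mul_comm]

variable [Fintype Λ]

theorem cubicForm_cubic (z : Λ → Bool) :
    cubicForm s.cubic z = ∑ k, z (s.target k) * s.poly k z := by
  simp only [cubic, map_sum, map_add, Finset.sum_apply, Pi.add_apply, cubicForm_single, poly,
    mul_add, Finset.mul_sum, BooleanRing.mul_self]
  simp only [mul_comm, mul_left_comm, mul_assoc]

theorem localMap_extend_unitary {K : Type} [Fintype K] [DecidableEq K] (e : K ↪ Λ)
    (U : K → Matrix.unitaryGroup Bool ℂ) (φ : QState Λ) (x : Λ → Bool) :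
    localMap (fun q => ((Function.extend e U 1 : Λ → Matrix.unitaryGroup Bool ℂ) q :
        Matrix Bool Bool ℂ)) φ x =
      localMap (fun k => (U k : Matrix Bool Bool ℂ)) (fun c => φ (Function.extend e c x))
        (x ∘ e) := by
  rw [← localMap_extend]
  congr 1
  funext q
  exact Function.apply_extend (F := fun A : Matrix.unitaryGroup Bool ℂ => (A : Matrix Bool Bool ℂ))
    ..

theorem run_sandwich (U U' : s.ι → Matrix.unitaryGroup Bool ℂ) (φ : QState Λ) (x : Λ → Bool) :
    CubicLayer.run (s.sandwich U U') φ x =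
      localMap (fun k => (U' k : Matrix Bool Bool ℂ) *
          Matrix.diagonal (fun b => boolSign (b * s.poly k x)) * (U k : Matrix Bool Bool ℂ))
        (fun c => φ (Function.extend s.target c x)) (x ∘ s.target) := by
  have extend_comp (c : s.ι → Bool) : Function.extend s.target c x ∘ s.target = c :=
    Function.extend_comp s.target.injective c x
  have extend_extend (c c' : s.ι → Bool) :
      Function.extend s.target c' (Function.extend s.target c x) =
        Function.extend s.target c' x := by
    funext q
    by_cases hq : q ∈ Set.range s.target
    · obtain ⟨k, rfl⟩ := hq
      simp only [s.target.injective.extend_apply]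
    · rw [Function.extend_apply' _ _ _ hq, Function.extend_apply' _ _ _ hq,
        Function.extend_apply' _ _ _ hq]
  have cubicForm_extend (c : s.ι → Bool) :
      cubicForm s.cubic (Function.extend s.target c x) = ∑ k, c k * s.poly k x := by
    rw [cubicForm_cubic]
    refine Finset.sum_congr rfl fun k _ => ?_
    rw [s.target.injective.extend_apply,
      s.poly_congr fun q hq => Function.extend_apply' c x q hq]
  simp only [sandwich, CubicLayer.run, List.foldl_cons, List.foldl_nil, CubicLayer.apply, map_zero,
    Pi.zero_apply, boolSign_zero, one_mul, localMap_extend_unitary, extend_comp, extend_extend,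
    cubicForm_extend, boolSign_sum]
  rw [← localMap_diagonal (fun k b => boolSign (b * s.poly k x)), localMap_mul, localMap_mul]

theorem run_add_sandwich {ι : Type} [Fintype ι] [DecidableEq ι] (target : ι ↪ Λ) {source : ι → Λ}
    (source_notMem : ∀ k, source k ∉ Set.range target) (U U' : ι → Matrix.unitaryGroup Bool ℂ)
    (φ : QState Λ) (x : Λ → Bool) :
    CubicLayer.run ((add target source source_notMem).sandwich U U') φ x =
      localMap (fun k => (U' k : Matrix Bool Bool ℂ) *
          Matrix.diagonal (fun b => boolSign (b * x (source k))) * (U k : Matrix Bool Bool ℂ))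
        (fun c => φ (Function.extend target c x)) (x ∘ target) := by
  have poly_eq (k) : (add target source source_notMem).poly k x = x (source k) :=
    poly_add target source_notMem k x
  rw [run_sandwich]
  congr 1
  funext k
  rw [poly_eq]

theorem hadamard_mul_diagonal_mul_hadamard (p : Bool) :
    hadamard * Matrix.diagonal (fun b => boolSign (b * p)) * hadamard =
      if p then notMatrix else 1 := by
  ext a b
  cases p <;> cases a <;> cases b <;>
    norm_num [notMatrix, Matrix.mul_apply, hadamard_apply, Bool.mul_eq_and,
      Matrix.diagonal_apply, rootHalf_mul_self]

theorem run_layers (φ : QState Λ) : CubicLayer.run s.layers φ = φ ∘ s.map := by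
  funext x
  rw [layers, run_sandwich]
  simp only [hadamard_mul_diagonal_mul_hadamard]
  rw [localMap_not fun k => s.poly k x]
  rfl

theorem run_program (ss : List (QuadStep Λ)) (φ : QState Λ) :
    CubicLayer.run (program ss) φ = φ ∘ mapAll ss := by
  induction ss generalizing φ with
  | nil => rfl
  | cons s ss ih =>
    rw [program, List.flatMap_cons, CubicLayer.run_append, run_layers]
    exact ih _

end Sandwich

end QuadStep

theorem sum_decide_eq_mul {ι : Type*} [Fintype ι] [DecidableEq ι] (a : ι) (f : ι → Bool) :
    ∑ r, decide (a = r) * f r = f a := by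
  rw [Finset.sum_eq_single a]
  · rw [decide_eq_true rfl]
    exact one_mul _
  · intro r _ hr
    rw [decide_eq_false hr.symm]
    exact zero_mul _
  · simp

/-! ### The registers -/

/-- The qubits of the preparation of Dicke states: the output bits; for each position `i` and each
number `s` of preceding ones a coin which decides about bit number `i`; the transition
matrices of segments of `2 ^ l` positions up to `i`; and for each `i` the number of preceding ones
in unary one-hot encoding. -/
inductive DickeReg (n L : ℕ) : Type
  | bit (i : Fin n)
  | coin (i : Fin n) (s : Fin (n + 1))
  | seg (l : Fin (L + 1)) (i : Fin n) (s t : Fin (n + 1))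
  | pos (i : Fin n) (s : Fin (n + 1))
  deriving DecidableEq

namespace DickeReg

variable {n L : ℕ}

/-- The registers as a sum type. -/
def equivSum : DickeReg n L ≃ Fin n ⊕ (Fin n × Fin (n + 1)) ⊕
    (Fin (L + 1) × Fin n × Fin (n + 1) × Fin (n + 1)) ⊕ (Fin n × Fin (n + 1)) where
  toFun
    | bit i => .inl i
    | coin i s => .inr (.inl (i, s))
    | seg l i s t => .inr (.inr (.inl (l, i, s, t)))
    | pos i s => .inr (.inr (.inr (i, s)))
  invFun
    | .inl i => bit i
    | .inr (.inl (i, s)) => coin i s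
    | .inr (.inr (.inl (l, i, s, t))) => seg l i s t
    | .inr (.inr (.inr (i, s))) => pos i s
  left_inv := by rintro (_ | _) <;> rfl
  right_inv := by rintro (_ | _ | _ | _) <;> rfl

instance : Fintype (DickeReg n L) := Fintype.ofEquiv _ equivSum.symm

theorem card_eq : Fintype.card (DickeReg n L) =
    n + (n * (n + 1) + ((L + 1) * (n * ((n + 1) * (n + 1))) + n * (n + 1))) := by
  rw [Fintype.card_congr equivSum]
  simp [Fintype.card_sum, Fintype.card_prod]

/-- The register of the output bits. -/
@[simps] def bitEmb : Fin n ↪ DickeReg n L := ⟨bit, fun i j h => by simpa using h⟩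

/-- The register of the coins. -/
@[simps] def coinEmb : Fin n × Fin (n + 1) ↪ DickeReg n L :=
  ⟨fun k => coin k.1 k.2, fun i j h => by simpa [Prod.ext_iff] using h⟩

/-- The register of the numbers of preceding ones. -/
@[simps] def posEmb : Fin n × Fin (n + 1) ↪ DickeReg n L :=
  ⟨fun k => pos k.1 k.2, fun i j h => by simpa [Prod.ext_iff] using h⟩

/-- The register of the transition matrices of segments of `2 ^ l` positions. -/
@[simps] def segEmb (l : Fin (L + 1)) : Fin n × Fin (n + 1) × Fin (n + 1) ↪ DickeReg n L :=
  ⟨fun k => seg l k.1 k.2.1 k.2.2, fun i j h => by simpa [Prod.ext_iff] using h⟩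

/-- The index `i` moved back by `d`, but not below the first index. -/
def backBy (i : Fin n) (d : ℕ) : Fin n := ⟨i - d, by omega⟩

/-! ### The number of preceding ones -/

section Path

variable (c c' : Fin n × Fin (n + 1) → Bool)

/-- The number of ones before position `i`, if bit number `i` is the value of the coin which belongs
to this number. -/
def path : ℕ → Fin (n + 1)
  | 0 => 0
  | i + 1 => path i + if h : i < n then (if c (⟨i, h⟩, path i) then 1 else 0) else 0

/-- The one-hot encoding of `path`. -/
def onPath (k : Fin n × Fin (n + 1)) : Bool := decide (path c k.1 = k.2)

/-- The transition matrix, for given coins, from the number of ones before position `i - 2 ^ l` to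
the number of ones before position `i`. -/
def segEntry : ℕ → Fin n → Fin (n + 1) → Fin (n + 1) → Bool
  | 0, i, s, t => decide (s = t) +
      (if i.val = 0 then 0 else decide (s = t) + decide (s + 1 = t)) * c (backBy i 1, s)
  | l + 1, i, s, t => ∑ r, segEntry l (backBy i (2 ^ l)) s r * segEntry l i r t

variable {c c'} in
theorem path_congr (h : ∀ i : Fin n, c (i, path c i) = c' (i, path c i)) (i : ℕ) :
    path c i = path c' i := by
  induction i with
  | zero => rfl
  | succ i ih =>
    rw [path, path, ← ih]
    by_cases hi : i < n
    · rw [dif_pos hi, dif_pos hi, h ⟨i, hi⟩]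
    · rw [dif_neg hi, dif_neg hi]

theorem sum_onPath_mul (i : Fin n) (f : Fin (n + 1) → Bool) :
    ∑ s, onPath c (i, s) * f s = f (path c i) :=
  sum_decide_eq_mul (path c i) f

theorem segEntry_zero_path (i : Fin n) (t : Fin (n + 1)) :
    segEntry c 0 i (path c (i - 1)) t = decide (path c i = t) := by
  rw [segEntry]
  obtain ⟨_ | j, hj⟩ := i
  · rw [if_pos rfl, zero_mul, add_zero]
    rfl
  · have path_succ := path.eq_2 c j
    rw [dif_pos (Nat.lt_of_succ_lt hj)] at path_succ
    simp only [backBy, Nat.add_sub_cancel, Nat.succ_ne_zero, if_false, path_succ]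
    cases c (⟨j, Nat.lt_of_succ_lt hj⟩, path c j)
    · rw [show (false : Bool) = 0 from rfl, mul_zero, add_zero]
      simp only [Bool.zero_eq_false, Bool.false_eq_true, if_false, add_zero]
    · rw [show (true : Bool) = 1 from rfl, mul_one, ← add_assoc, BooleanRing.add_self, zero_add]
      simp only [Bool.one_eq_true, if_true]

theorem segEntry_path (l : ℕ) (i : Fin n) (t : Fin (n + 1)) :
    segEntry c l i (path c (i - 2 ^ l)) t = decide (path c i = t) := by
  induction l generalizing i t with
  | zero => exact segEntry_zero_path c i t
  | succ l ih =>
    have back_back : (backBy i (2 ^ l)).val - 2 ^ l = i.val - 2 ^ (l + 1) := by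
      rw [backBy, Nat.sub_sub, pow_succ, mul_two]
    simp only [segEntry, ← back_back, ih]
    exact (sum_decide_eq_mul _ _).trans (ih i t)

end Path

/-! ### The computation of the numbers of preceding ones -/

/-- The transition matrices of segments of length one. -/
def initStep (n L : ℕ) : QuadStep (DickeReg n L) where
  ι := Fin n × Fin (n + 1) × Fin (n + 1)
  R := Unit
  target := segEmb 0
  const k := decide (k.2.1 = k.2.2)
  coef k _ := if k.1.val = 0 then 0 else decide (k.2.1 = k.2.2) + decide (k.2.1 + 1 = k.2.2)
  left k _ := coin (backBy k.1 1) k.2.1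
  right k _ := coin (backBy k.1 1) k.2.1
  left_notMem _ _ := by simp
  right_notMem _ _ := by simp

/-- The transition matrices of segments of doubled length, as matrix products. -/
def mulStep (l : Fin L) : QuadStep (DickeReg n L) :=
  .dot (segEmb l.succ) (fun k r => seg l.castSucc (backBy k.1 (2 ^ l.val)) k.2.1 r)
    (fun k r => seg l.castSucc k.1 r k.2.2) (by simp [Fin.ext_iff])
    (by simp [Fin.ext_iff])

/-- The numbers of preceding ones, as first rows of the transition matrices of maximal length. -/
def posStep (n L : ℕ) : QuadStep (DickeReg n L) :=
  .add posEmb (fun k => seg (Fin.last L) k.1 0 k.2) (by simp)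

/-- The computation of the transition matrices of segments of length up to `2 ^ m`. -/
def segSteps (n : ℕ) {L : ℕ} : (m : ℕ) → m ≤ L → List (QuadStep (DickeReg n L))
  | 0, _ => [initStep n L]
  | m + 1, h => segSteps n m (Nat.le_of_succ_le h) ++ [mulStep ⟨m, h⟩]

/-- The computation of the numbers of preceding ones. -/
def pathSteps (n L : ℕ) : List (QuadStep (DickeReg n L)) :=
  segSteps n L le_rfl ++ ([posStep n L] ++ (segSteps n L le_rfl).reverse)

theorem length_segSteps (n : ℕ) {L : ℕ} : ∀ (m : ℕ) (h : m ≤ L),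
    (segSteps n m h).length = m + 1
  | 0, _ => rfl
  | m + 1, h => by rw [segSteps, List.length_append, length_segSteps n m]; rfl

theorem length_pathSteps (n L : ℕ) : (pathSteps n L).length = 2 * L + 3 := by
  rw [pathSteps, List.length_append, List.length_append, List.length_reverse, length_segSteps,
    List.length_singleton]
  ring

/-- The transition matrices are zero. -/
def SegZero (z : DickeReg n L → Bool) : Prop := ∀ l, z ∘ segEmb l = 0

/-- The assignment `z` with the correct transition matrices of segments of length up to `2 ^ m`. -/
def fillSeg (m : ℕ) (z : DickeReg n L → Bool) : DickeReg n L → Bool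
  | seg l i s t => if l.val ≤ m then segEntry (z ∘ coinEmb) l i s t else z (seg l i s t)
  | q => z q

/-- The assignment `z` after the addition of the numbers of preceding ones. -/
def addPath (z : DickeReg n L → Bool) : DickeReg n L → Bool
  | pos i s => z (pos i s) + onPath (z ∘ coinEmb) (i, s)
  | q => z q

theorem SegZero.apply {z : DickeReg n L → Bool} (hz : SegZero z) (l : Fin (L + 1)) (i : Fin n)
    (s t : Fin (n + 1)) : z (seg l i s t) = 0 :=
  congrFun (hz l) (i, s, t)

theorem map_initStep {z : DickeReg n L → Bool} (hz : SegZero z) :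
    (initStep n L).map z = fillSeg 0 z := by
  funext q
  by_cases hq : q ∈ Set.range (segEmb (n := n) (L := L) 0)
  · obtain ⟨⟨i, s, t⟩, rfl⟩ := hq
    refine ((initStep n L).map_target z (i, s, t)).trans ?_
    change z (seg 0 i s t) + (_ + ∑ _r : Unit, _ * (z (coin _ s) * z (coin _ s))) =
      segEntry (z ∘ coinEmb) 0 i s t
    rw [hz.apply, zero_add, Fintype.sum_unique, BooleanRing.mul_self]
    rfl
  · rw [(initStep n L).map_of_notMem z hq]
    cases q with
    | seg l i s t =>
      have : ¬l.val ≤ 0 := fun h => hq ⟨(i, s, t), by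
        rw [show l = 0 from Fin.ext (Nat.le_zero.mp h)]; rfl⟩
      rw [fillSeg, if_neg this]
    | _ => rfl

theorem map_mulStep (l : Fin L) {z : DickeReg n L → Bool} (hz : SegZero z) :
    (mulStep l).map (fillSeg l z) = fillSeg (l + 1) z := by
  funext q
  by_cases hq : q ∈ Set.range (segEmb (n := n) l.succ)
  · obtain ⟨⟨i, s, t⟩, rfl⟩ := hq
    refine (QuadStep.dot_map_target (segEmb l.succ) _ _ _ (i, s, t)).trans ?_
    change fillSeg l z (seg l.succ i s t) + _ = fillSeg (l + 1) z (seg l.succ i s t)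
    simp only [fillSeg, Fin.val_succ, Nat.not_succ_le_self, if_false, hz.apply, zero_add,
      Fin.val_castSucc, le_refl, if_true, segEntry]
  · rw [(mulStep l).map_of_notMem _ hq]
    cases q with
    | seg l' i s t =>
      have ne : l'.val ≠ l.val + 1 := fun h => hq ⟨(i, s, t), by
        rw [show l' = l.succ from Fin.ext h]; rfl⟩
      have le_iff : l'.val ≤ l.val ↔ l'.val ≤ l.val + 1 := by omega
      simp only [fillSeg, le_iff]
    | _ => rfl

theorem mapAll_segSteps {z : DickeReg n L → Bool} (hz : SegZero z) : ∀ (m : ℕ) (h : m ≤ L),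
    QuadStep.mapAll (segSteps n m h).reverse z = fillSeg m z
  | 0, _ => map_initStep hz
  | m + 1, h => by
    rw [segSteps, List.reverse_append, QuadStep.mapAll_append, mapAll_segSteps hz m _]
    exact map_mulStep ⟨m, h⟩ hz

theorem map_posStep (hL : n ≤ 2 ^ L) (z : DickeReg n L → Bool) :
    (posStep n L).map (fillSeg L z) = fillSeg L (addPath z) := by
  funext q
  by_cases hq : q ∈ Set.range (posEmb (n := n) (L := L))
  · obtain ⟨⟨i, s⟩, rfl⟩ := hq
    have segEntry_last := segEntry_path (z ∘ coinEmb) L i s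
    rw [Nat.sub_eq_zero_of_le (i.2.le.trans hL)] at segEntry_last
    refine (QuadStep.add_map_target posEmb _ _ (i, s)).trans ?_
    change z (pos i s) + fillSeg L z (seg (Fin.last L) i 0 s) = z (pos i s) + onPath _ (i, s)
    rw [fillSeg, Fin.val_last, if_pos le_rfl, onPath, ← segEntry_last]
    rfl
  · rw [(posStep n L).map_of_notMem _ hq]
    cases q with
    | pos i s => exact absurd ⟨(i, s), rfl⟩ hq
    | _ => rfl

theorem mapAll_pathSteps (hL : n ≤ 2 ^ L) {z : DickeReg n L → Bool} (hz : SegZero z) :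
    QuadStep.mapAll (pathSteps n L) z = addPath z := by
  rw [pathSteps, QuadStep.mapAll_append, QuadStep.mapAll_append, mapAll_segSteps hz]
  change QuadStep.mapAll _ ((posStep n L).map (fillSeg L z)) = _
  rw [map_posStep hL, ← mapAll_segSteps (z := addPath z) hz L le_rfl,
    QuadStep.mapAll_mapAll_reverse]

theorem mapAll_pathSteps_mapAll_pathSteps (z : DickeReg n L → Bool) :
    QuadStep.mapAll (pathSteps n L) (QuadStep.mapAll (pathSteps n L) z) = z := by
  have palindrome : (pathSteps n L).reverse = pathSteps n L := by
    simp [pathSteps]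
  have := QuadStep.mapAll_mapAll_reverse (pathSteps n L) z
  rwa [palindrome] at this

theorem segZero_mapAll_pathSteps (hL : n ≤ 2 ^ L) {z : DickeReg n L → Bool} :
    SegZero (QuadStep.mapAll (pathSteps n L) z) ↔ SegZero z := by
  have of_segZero {z : DickeReg n L → Bool} (hz : SegZero z) :
      SegZero (QuadStep.mapAll (pathSteps n L) z) :=
    mapAll_pathSteps hL hz ▸ hz
  exact ⟨fun h => mapAll_pathSteps_mapAll_pathSteps z ▸ of_segZero h, of_segZero⟩

end DickeReg

/-! ### States with vanishing transition matrices -/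

namespace DickeReg

variable {n L : ℕ}

/-- The bits chosen by the coins. -/
def bitStep (n L : ℕ) : QuadStep (DickeReg n L) :=
  .dot bitEmb (fun i s => pos i s) (fun i s => coin i s) (by simp) (by simp)

/-- The erasure of the coins which have been used. -/
def clearStep (n L : ℕ) : QuadStep (DickeReg n L) :=
  .dot (R := Unit) coinEmb (fun k _ => pos k.1 k.2) (fun k _ => bit k.1) (by simp) (by simp)

/-- The addition of the bits to the coins. -/
def copyStep (n L : ℕ) : QuadStep (DickeReg n L) := .add coinEmb (fun k => bit k.1) (by simp)

/-- The coupling of the coins to the numbers of preceding ones. -/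
abbrev controlStep (n L : ℕ) : QuadStep (DickeReg n L) :=
  .add coinEmb (fun k => pos k.1 k.2) (by simp)

open scoped Classical in
/-- The state with the amplitudes `f x c p` for the values `x` of the output bits, `c` of the coins
and `p` of the numbers of preceding ones, in which the transition matrices are zero. -/
noncomputable def registerState
    (f : (Fin n → Bool) → (Fin n × Fin (n + 1) → Bool) → (Fin n × Fin (n + 1) → Bool) → ℂ) :
    QState (DickeReg n L) := fun z =>
  if SegZero z then f (z ∘ bitEmb) (z ∘ coinEmb) (z ∘ posEmb) else 0

theorem forall_notMem_range_bitEmb {z : DickeReg n L → Bool} :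
    (∀ q ∉ Set.range bitEmb, z q = false) ↔
      SegZero z ∧ z ∘ coinEmb = 0 ∧ z ∘ posEmb = 0 := by
  constructor
  · exact fun h => ⟨fun l => funext fun k => h _ (by simp), funext fun k => h _ (by simp),
      funext fun k => h _ (by simp)⟩
  · rintro ⟨hseg, hcoin, hpos⟩ q hq
    cases q with
    | bit i => exact absurd ⟨i, rfl⟩ hq
    | coin i s => exact congrFun hcoin (i, s)
    | seg l i s t => exact hseg.apply l i s t
    | pos i s => exact congrFun hpos (i, s)

theorem withAncillas_bitEmb (ψ : QState (Fin n)) :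
    withAncillas (bitEmb (L := L)) ψ =
      registerState fun x c p => if c = 0 ∧ p = 0 then ψ x else 0 := by
  funext z
  have iff_and := forall_notMem_range_bitEmb (z := z)
  by_cases hz : ∀ q ∉ Set.range bitEmb, z q = false
  · have hz' := iff_and.mp hz
    rw [withAncillas, if_pos hz, registerState, if_pos hz'.1, if_pos hz'.2]
    rfl
  · have hz' := mt iff_and.mpr hz
    rw [withAncillas, if_neg hz, registerState, ← ite_and, if_neg hz']

theorem zeroState_eq_registerState :
    zeroState (DickeReg n L) =
      registerState fun x c p => if c = 0 ∧ p = 0 then zeroState (Fin n) x else 0 := by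
  rw [← withAncillas_bitEmb, zeroState_eq_embedState bitEmb]
  funext z
  let support : Set (DickeReg n L → Bool) := {z | ∀ q ∉ Set.range bitEmb, z q = 0}
  by_cases hz : ∀ q ∉ Set.range bitEmb, z q = false
  · rw [withAncillas, if_pos hz]
    exact Set.indicator_of_mem (s := support) hz _
  · rw [withAncillas, if_neg hz]
    exact Set.indicator_of_notMem (s := support) hz _

section Run

variable
  (f g : (Fin n → Bool) → (Fin n × Fin (n + 1) → Bool) → (Fin n × Fin (n + 1) → Bool) → ℂ)

variable {f g} in
theorem registerState_congr {z z' : DickeReg n L → Bool} (hseg : SegZero z ↔ SegZero z')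
    (h : SegZero z' → f (z ∘ bitEmb) (z ∘ coinEmb) (z ∘ posEmb) =
      g (z' ∘ bitEmb) (z' ∘ coinEmb) (z' ∘ posEmb)) :
    registerState f z = registerState g z' :=
  open scoped Classical in ite_congr (propext hseg) h fun _ => rfl

theorem run_pathSteps (hL : n ≤ 2 ^ L) :
    CubicLayer.run (QuadStep.program (pathSteps n L)) (registerState f) =
      registerState fun x c p => f x c (p + onPath c) := by
  rw [QuadStep.run_program]
  refine funext fun z => registerState_congr (segZero_mapAll_pathSteps hL) fun hz => ?_
  rw [mapAll_pathSteps hL hz]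
  rfl

theorem run_bitStep :
    CubicLayer.run (bitStep n L).layers (registerState f) =
      registerState fun x c p => f (fun i => x i + ∑ s, p (i, s) * c (i, s)) c p := by
  rw [QuadStep.run_layers]
  funext z
  have map_seg (l) : (bitStep n L).map z ∘ segEmb l = z ∘ segEmb l :=
    QuadStep.map_comp_of_notMem _ z (by rintro _ ⟨_, ⟨⟩⟩)
  have map_bit : (bitStep n L).map z ∘ bitEmb = _ :=
    funext fun i => QuadStep.dot_map_target bitEmb _ _ z i
  have map_coin : (bitStep n L).map z ∘ coinEmb = z ∘ coinEmb :=
    QuadStep.map_comp_of_notMem _ z (by rintro _ ⟨_, ⟨⟩⟩)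
  have map_pos : (bitStep n L).map z ∘ posEmb = z ∘ posEmb :=
    QuadStep.map_comp_of_notMem _ z (by rintro _ ⟨_, ⟨⟩⟩)
  refine registerState_congr (forall_congr' fun l => by rw [map_seg]) fun _ => ?_
  rw [map_bit, map_coin, map_pos]
  rfl

theorem run_clearStep :
    CubicLayer.run (clearStep n L).layers (registerState f) =
      registerState fun x c p => f x (fun k => c k + p k * x k.1) p := by
  rw [QuadStep.run_layers]
  funext z
  have map_seg (l) : (clearStep n L).map z ∘ segEmb l = z ∘ segEmb l :=
    QuadStep.map_comp_of_notMem _ z (by rintro _ ⟨_, ⟨⟩⟩)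
  have map_coin : (clearStep n L).map z ∘ coinEmb = _ :=
    funext fun k => QuadStep.dot_map_target coinEmb _ _ z k
  have map_bit : (clearStep n L).map z ∘ bitEmb = z ∘ bitEmb :=
    QuadStep.map_comp_of_notMem _ z (by rintro _ ⟨_, ⟨⟩⟩)
  have map_pos : (clearStep n L).map z ∘ posEmb = z ∘ posEmb :=
    QuadStep.map_comp_of_notMem _ z (by rintro _ ⟨_, ⟨⟩⟩)
  refine registerState_congr (forall_congr' fun l => by rw [map_seg]) fun _ => ?_
  simp only [map_bit, map_coin, map_pos, Fintype.sum_unique]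
  rfl

theorem run_copyStep :
    CubicLayer.run (copyStep n L).layers (registerState f) =
      registerState fun x c p => f x (fun k => c k + x k.1) p := by
  rw [QuadStep.run_layers]
  funext z
  have map_seg (l) : (copyStep n L).map z ∘ segEmb l = z ∘ segEmb l :=
    QuadStep.map_comp_of_notMem _ z (by rintro _ ⟨_, ⟨⟩⟩)
  have map_coin : (copyStep n L).map z ∘ coinEmb = _ :=
    funext fun k => QuadStep.add_map_target coinEmb _ z k
  have map_bit : (copyStep n L).map z ∘ bitEmb = z ∘ bitEmb :=
    QuadStep.map_comp_of_notMem _ z (by rintro _ ⟨_, ⟨⟩⟩)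
  have map_pos : (copyStep n L).map z ∘ posEmb = z ∘ posEmb :=
    QuadStep.map_comp_of_notMem _ z (by rintro _ ⟨_, ⟨⟩⟩)
  refine registerState_congr (forall_congr' fun l => by rw [map_seg]) fun _ => ?_
  rw [map_bit, map_coin, map_pos]
  rfl

theorem localMap_registerState (A : Fin n × Fin (n + 1) → Matrix Bool Bool ℂ)
    (z : DickeReg n L → Bool) :
    localMap A (fun c => registerState f (Function.extend coinEmb c z)) (z ∘ coinEmb) =
      registerState (fun x c p => localMap A (fun c => f x c p) c) z := by
  have extend_of_notMem (c : Fin n × Fin (n + 1) → Bool) {K : Type} {e : K → DickeReg n L}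
      (he : ∀ k, e k ∉ Set.range coinEmb) : Function.extend coinEmb c z ∘ e = z ∘ e :=
    funext fun k => Function.extend_apply' _ _ _ (he k)
  have on_seg (c l) : Function.extend coinEmb c z ∘ segEmb l = z ∘ segEmb l :=
    extend_of_notMem c (by simp)
  have on_bit (c) : Function.extend coinEmb c z ∘ bitEmb = z ∘ bitEmb :=
    extend_of_notMem c (by simp)
  have on_pos (c) : Function.extend coinEmb c z ∘ posEmb = z ∘ posEmb :=
    extend_of_notMem c (by simp)
  have registerState_extend (c) : registerState f (Function.extend coinEmb c z) =
      registerState (fun x _ p => f x c p) z :=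
    registerState_congr (forall_congr' fun l => by rw [on_seg]) fun _ => by
      rw [on_bit, on_pos, Function.extend_comp coinEmb.injective]
  simp only [registerState_extend]
  by_cases hz : SegZero z
  · simp only [registerState, if_pos hz]
  · simp only [registerState, if_neg hz, localMap, mul_zero, Finset.sum_const_zero]

theorem run_coinGates (U : Fin n × Fin (n + 1) → Matrix.unitaryGroup Bool ℂ) :
    CubicLayer.run [⟨Function.extend coinEmb U 1, 0⟩] (registerState (L := L) f) =
      registerState fun x c p =>
        localMap (fun k => (U k : Matrix Bool Bool ℂ)) (fun c => f x c p) c := by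
  funext z
  simp only [CubicLayer.run, List.foldl_cons, List.foldl_nil, CubicLayer.apply, map_zero,
    Pi.zero_apply, boolSign_zero, one_mul, QuadStep.localMap_extend_unitary,
    localMap_registerState]

theorem run_controlStep_sandwich (U U' : Fin n × Fin (n + 1) → Matrix.unitaryGroup Bool ℂ) :
    CubicLayer.run ((controlStep n L).sandwich U U') (registerState f) =
      registerState fun x c p =>
        localMap (fun k => (U' k : Matrix Bool Bool ℂ) *
          Matrix.diagonal (fun b => boolSign (b * p k)) * (U k : Matrix Bool Bool ℂ))
          (fun c => f x c p) c := by
  funext z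
  rw [QuadStep.run_add_sandwich, localMap_registerState]
  exact registerState_congr Iff.rfl fun _ => rfl

end Run

end DickeReg

/-! ### Coins -/

/-- The rotation by the angle `θ`. -/
noncomputable def rotationMatrix (θ : ℝ) : Matrix Bool Bool ℂ :=
  Matrix.of fun a b => if a = b then (Real.cos θ : ℂ) else boolSign b * (Real.sin θ : ℂ)

theorem rotationMatrix_add (θ η : ℝ) :
    rotationMatrix (θ + η) = rotationMatrix θ * rotationMatrix η := by
  ext a b
  cases a <;> cases b <;>
    simp [rotationMatrix, Matrix.mul_apply, Complex.cos_add, Complex.sin_add] <;> ring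

theorem star_rotationMatrix (θ : ℝ) : star (rotationMatrix θ) = rotationMatrix (-θ) := by
  ext a b
  cases a <;> cases b <;>
    simp [rotationMatrix, Matrix.star_apply, -Complex.ofReal_cos, -Complex.ofReal_sin]

theorem rotationMatrix_mem (θ : ℝ) : rotationMatrix θ ∈ Matrix.unitaryGroup Bool ℂ := by
  rw [Matrix.mem_unitaryGroup_iff, star_rotationMatrix, ← rotationMatrix_add, add_neg_cancel]
  ext a b
  simp [rotationMatrix, Matrix.one_apply]

theorem diagonal_boolSign_mul_rotationMatrix_neg (θ : ℝ) :
    Matrix.diagonal boolSign * rotationMatrix (-θ) =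
      rotationMatrix θ * Matrix.diagonal boolSign := by
  ext a b
  cases a <;> cases b <;> simp [rotationMatrix]

/-- The Pauli gate `Z`, which changes the sign of the basis state one. -/
noncomputable def signGate : Matrix.unitaryGroup Bool ℂ := phaseGate (-1)

theorem coe_signGate : (signGate : Matrix Bool Bool ℂ) = Matrix.diagonal boolSign := rfl

theorem signGate_mul_self : signGate * signGate = 1 := by
  refine Subtype.ext ?_
  rw [Submonoid.coe_mul, coe_signGate, Matrix.diagonal_mul_diagonal]
  simp only [boolSign_mul_self, Matrix.diagonal_one, Submonoid.coe_one]

/-- The rotation by half the angle at which a coin is one with probability `j / m`. -/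
noncomputable def coinRotation (m j : ℕ) : Matrix.unitaryGroup Bool ℂ :=
  ⟨_, rotationMatrix_mem (Real.arcsin √(j / m) / 2)⟩

/-- The toss of a coin which is one with probability `j / m`, as a reflection. -/
noncomputable def coinGate (m j : ℕ) : Matrix.unitaryGroup Bool ℂ :=
  coinRotation m j * signGate * (coinRotation m j)⁻¹

theorem coe_coinGate (m j : ℕ) : (coinGate m j : Matrix Bool Bool ℂ) =
    rotationMatrix (Real.arcsin √(j / m)) * Matrix.diagonal boolSign := by
  let half := Real.arcsin √(j / m) / 2
  calc
    _ = rotationMatrix half * Matrix.diagonal boolSign * star (rotationMatrix half) := rfl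
    _ = rotationMatrix (half + half) * Matrix.diagonal boolSign := by
      rw [star_rotationMatrix, mul_assoc, diagonal_boolSign_mul_rotationMatrix_neg,
        rotationMatrix_add, mul_assoc]
    _ = _ := by rw [add_halves]

theorem coinGate_mul_self (m j : ℕ) : coinGate m j * coinGate m j = 1 := by
  rw [coinGate, conj_mul, signGate_mul_self, mul_one, mul_inv_cancel]

/-- The amplitude of the outcome `b` of a coin which is one with probability `j / m`. -/
noncomputable def coinAmp (m j : ℕ) (b : Bool) : ℂ := (coinGate m j : Matrix Bool Bool ℂ) b false

theorem coinAmp_true {m j : ℕ} (hj : j ≤ m) : coinAmp m j true = (√(j / m) : ℝ) := by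
  have sqrt_le_one : √(j / m : ℝ) ≤ 1 :=
    Real.sqrt_le_one.mpr (div_le_one_of_le₀ (Nat.cast_le.mpr hj) (Nat.cast_nonneg m))
  rw [← Real.sin_arcsin (neg_one_lt_zero.le.trans (Real.sqrt_nonneg _)) sqrt_le_one, coinAmp,
    coe_coinGate]
  simp [rotationMatrix]

theorem coinAmp_false (m j : ℕ) : coinAmp m j false = (√(1 - j / m) : ℝ) := by
  have cos_eq := Real.cos_arcsin √(j / m)
  rw [Real.sq_sqrt (by positivity)] at cos_eq
  rw [← cos_eq, coinAmp, coe_coinGate]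
  simp [rotationMatrix]

theorem sqrt_mul_inv_sqrt {a b c : ℝ} (hb : 0 < b) (hc : 0 < c) (h : a * c = b) :
    √a * (√b)⁻¹ = (√c)⁻¹ := by
  rw [eq_div_of_mul_eq hc.ne' h, Real.sqrt_div hb.le, div_mul_eq_mul_div,
    mul_inv_cancel₀ (Real.sqrt_ne_zero'.mpr hb), one_div]

theorem coinAmp_true_mul {m j : ℕ} (hj : j ≤ m) :
    coinAmp (m + 1) (j + 1) true * ((√(m.choose j))⁻¹ : ℝ) =
      ((√((m + 1).choose (j + 1)))⁻¹ : ℝ) := by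
  have hj' : j + 1 ≤ m + 1 := Nat.succ_le_succ hj
  have choose_mul : ((m + 1 : ℕ) : ℝ) * m.choose j = (m + 1).choose (j + 1) * (j + 1 : ℕ) := by
    exact_mod_cast Nat.add_one_mul_choose_eq m j
  rw [coinAmp_true hj', ← Complex.ofReal_mul, sqrt_mul_inv_sqrt
    (Nat.cast_pos.mpr (Nat.choose_pos hj)) (Nat.cast_pos.mpr (Nat.choose_pos hj'))]
  rw [div_mul_eq_mul_div, div_eq_iff (by positivity)]
  linear_combination -choose_mul

theorem coinAmp_false_mul {m j : ℕ} (hj : j ≤ m) :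
    coinAmp (m + 1) j false * ((√(m.choose j))⁻¹ : ℝ) = ((√((m + 1).choose j))⁻¹ : ℝ) := by
  have hj' : j ≤ m + 1 := Nat.le_succ_of_le hj
  have choose_mul : (m.choose j : ℝ) * (m + 1 : ℕ) = (m + 1).choose j * ((m + 1 : ℕ) - j) := by
    rw [← Nat.cast_sub hj']
    exact_mod_cast Nat.choose_mul_succ_eq m j
  rw [coinAmp_false, ← Complex.ofReal_mul, sqrt_mul_inv_sqrt
    (Nat.cast_pos.mpr (Nat.choose_pos hj)) (Nat.cast_pos.mpr (Nat.choose_pos hj'))]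
  rw [one_sub_div (by positivity), div_mul_eq_mul_div, div_eq_iff (by positivity)]
  linear_combination -choose_mul

theorem prod_coinAmp {m j : ℕ} (hj : j ≤ m) (x : ℕ → Bool) :
    ∏ i ∈ Finset.range m, coinAmp (m - i) (j - Nat.count (x · = true) i) (x i) =
      if Nat.count (x · = true) m = j then (((√(m.choose j))⁻¹ : ℝ) : ℂ) else 0 := by
  induction m generalizing j x with
  | zero =>
    obtain rfl := Nat.le_zero.mp hj
    simp
  | succ m ih =>
    rw [Finset.prod_range_succ']
    simp only [Nat.count_succ', Nat.count_zero, Nat.sub_zero, Nat.add_sub_add_right]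
    have count_le : Nat.count (x <| · + 1) m ≤ m := Nat.count_le _
    cases hx : x 0
    · simp only [Bool.false_eq_true, if_false, add_zero]
      obtain rfl | hj := Nat.eq_or_lt_of_le hj
      · rw [coinAmp_false, div_self (by positivity), sub_self, Real.sqrt_zero, Complex.ofReal_zero,
          mul_zero, if_neg (by omega)]
      · rw [ih (Nat.le_of_lt_succ hj) fun i => x (i + 1), mul_comm, mul_ite, mul_zero,
          coinAmp_false_mul (Nat.le_of_lt_succ hj)]
    · simp only [if_true]
      cases j with
      | zero => simp [coinAmp_true]
      | succ j =>
        simp only [Nat.add_sub_add_right, Nat.add_right_cancel_iff]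
        rw [ih (Nat.le_of_succ_le_succ hj) fun i => x (i + 1), mul_comm, mul_ite, mul_zero,
          coinAmp_true_mul (Nat.le_of_succ_le_succ hj)]

namespace DickeReg

variable {n : ℕ}

/-- The string `x`, continued by zeros. -/
def bitSeq (x : Fin n → Bool) (i : ℕ) : Bool := if h : i < n then x ⟨i, h⟩ else false

theorem bitSeq_val (x : Fin n → Bool) (i : Fin n) : bitSeq x i = x i := dif_pos i.2

theorem val_path_bits (x : Fin n → Bool) {i : ℕ} (hi : i ≤ n) :
    (path (fun k => x k.1) i).val = Nat.count (bitSeq x · = true) i := by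
  induction i with
  | zero => rfl
  | succ i ih =>
    have count_le : Nat.count (bitSeq x · = true) i ≤ i := Nat.count_le _
    rw [path, dif_pos (Nat.lt_of_succ_le hi), Fin.val_add, ih (Nat.le_of_succ_le hi),
      Nat.count_succ, ← bitSeq_val x ⟨i, hi⟩]
    split_ifs
    · rw [Fin.val_one', Nat.add_mod_mod, Nat.mod_eq_of_lt (by omega)]
    · rw [Fin.val_zero, Nat.mod_eq_of_lt (by omega)]

theorem count_bitSeq (x : Fin n → Bool) :
    Nat.count (bitSeq x · = true) n = (Finset.univ.filter fun i => x i = true).card := by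
  rw [Nat.count_eq_card_filter_range, Finset.card_filter, Finset.card_filter,
    ← Fin.sum_univ_eq_sum_range fun i => if bitSeq x i = true then 1 else 0]
  simp only [bitSeq_val]

theorem prod_coinAmp_path {k : ℕ} (hk : k ≤ n) (x : Fin n → Bool) :
    ∏ p : Fin n × Fin (n + 1), (if onPath (fun q => x q.1) p
      then coinAmp (n - p.1) (k - p.2) (x p.1) else 1) = dickeState n k x := by
  rw [Fintype.prod_prod_type, dickeState, ← count_bitSeq, ← prod_coinAmp hk (bitSeq x),
    ← Fin.prod_univ_eq_prod_range
      fun i => coinAmp (n - i) (k - Nat.count (bitSeq x · = true) i) (bitSeq x i)]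
  refine Finset.prod_congr rfl fun i _ => ?_
  simp only [onPath, decide_eq_true_eq]
  rw [Finset.prod_ite_eq, if_pos (Finset.mem_univ _), val_path_bits x i.2.le, bitSeq_val]

end DickeReg

/-! ### The preparation of Dicke states -/

namespace DickeReg

variable {n L : ℕ}

/-- The coin for bit number `p.1` with `p.2` preceding ones, which is one with the proportion of the
missing ones among the remaining positions as its probability. -/
noncomputable def tossGate (n k : ℕ) (p : Fin n × Fin (n + 1)) : Matrix.unitaryGroup Bool ℂ :=
  coinGate (n - p.1) (k - p.2)

/-- The toss of all coins. -/
noncomputable def tossLayer (n k L : ℕ) : CubicLayer (DickeReg n L) :=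
  ⟨Function.extend coinEmb (tossGate n k) 1, 0⟩

/-- The toss is taken back for the coins which have not been used. -/
noncomputable def untossLayers (n k L : ℕ) : List (CubicLayer (DickeReg n L)) :=
  (controlStep n L).sandwich (fun p => (coinRotation (n - p.1) (k - p.2))⁻¹)
    fun p => coinRotation (n - p.1) (k - p.2) * signGate

/-- The choice of the bits by the coins, and the erasure of the coins which have been used. -/
noncomputable def chooseLayers (n L : ℕ) : List (CubicLayer (DickeReg n L)) :=
  QuadStep.program (pathSteps n L) ++ ((bitStep n L).layers ++ (clearStep n L).layers)

/-- The erasure of the numbers of preceding ones, recomputed from the output bits. -/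
noncomputable def uncomputeLayers (n L : ℕ) : List (CubicLayer (DickeReg n L)) :=
  (copyStep n L).layers ++ (QuadStep.program (pathSteps n L) ++ (copyStep n L).layers)

/-- The layers which prepare the Dicke state. -/
noncomputable def dickeLayers (n k L : ℕ) : List (CubicLayer (DickeReg n L)) :=
  tossLayer n k L :: (chooseLayers n L ++ (untossLayers n k L ++ uncomputeLayers n L))

theorem length_dickeLayers (n k L : ℕ) : (dickeLayers n k L).length = 8 * L + 23 := by
  simp only [dickeLayers, chooseLayers, untossLayers, uncomputeLayers, QuadStep.sandwich,
    QuadStep.layers, List.length_cons, List.length_append, List.length_nil,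
    QuadStep.length_program, length_pathSteps]
  ring

theorem run_tossLayer (k : ℕ) :
    CubicLayer.run [tossLayer n k L] (zeroState (DickeReg n L)) =
      registerState fun x c p => if x = 0 ∧ p = 0 then
        ∏ q : Fin n × Fin (n + 1), coinAmp (n - q.1) (k - q.2) (c q) else 0 := by
  rw [zeroState_eq_registerState, tossLayer, run_coinGates]
  congr 1
  funext x c p
  have eq_smul : (fun c => if c = 0 ∧ p = 0 then zeroState (Fin n) x else 0) =
      (if x = 0 ∧ p = 0 then 1 else 0 : ℂ) • zeroState (Fin n × Fin (n + 1)) := by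
    funext c
    have zeroState_apply {V : Type} (y : V → Bool) :
        zeroState V y = open scoped Classical in if y = 0 then 1 else 0 := by
      classical exact if_congr funext_iff.symm rfl rfl
    simp only [Pi.smul_apply, zeroState_apply, smul_eq_mul]
    split_ifs <;> simp_all
  rw [eq_smul, localMap_smul, Pi.smul_apply, localMap_zeroState, ite_smul, one_smul, zero_smul]
  rfl

theorem chosen_iff (x : Fin n → Bool) (c p : Fin n × Fin (n + 1) → Bool) :
    ((fun i => x i + ∑ s, p (i, s) * c (i, s)) = 0 ∧ p + onPath c = 0) ↔
      p = onPath (fun q => x q.1) ∧ ∀ q, p q = true → c q = x q.1 := by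
  -- A path depends only on the coins on it, so the coins and the chosen bits have the same path.
  have apply_eq_iff (d : Fin n × Fin (n + 1) → Bool) :
      (∀ q, onPath d q = true → c q = x q.1) ↔ ∀ i, c (i, path d i) = x i := by
    simp [onPath, Prod.forall]
  have onPath_eq {d d' : Fin n × Fin (n + 1) → Bool}
      (h : ∀ i : Fin n, d (i, path d i) = d' (i, path d i)) : onPath d = onPath d' := by
    funext q
    rw [onPath, onPath, path_congr h]
  have left_iff : ((fun i => x i + ∑ s, p (i, s) * c (i, s)) = 0 ∧ p + onPath c = 0) ↔
      p = onPath c ∧ ∀ i, c (i, path c i) = x i := by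
    simp only [funext_iff, Pi.add_apply, Pi.zero_apply, BooleanRing.add_eq_zero']
    rw [and_comm, ← funext_iff]
    refine and_congr_right ?_
    rintro rfl
    exact forall_congr' fun i => by rw [sum_onPath_mul c i fun s => c (i, s), eq_comm]
  rw [left_iff]
  constructor
  · rintro ⟨rfl, h⟩
    have := onPath_eq (d' := fun q => x q.1) h
    exact ⟨this, (apply_eq_iff c).mpr h⟩
  · rintro ⟨rfl, h⟩
    have h' := (apply_eq_iff fun q => x q.1).mp h
    have := onPath_eq (d := fun q => x q.1) (d' := c) fun i => (h' i).symm
    exact ⟨this, (apply_eq_iff c).mp (this ▸ h)⟩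

theorem run_chooseLayers (hL : n ≤ 2 ^ L) (amp : Fin n × Fin (n + 1) → Bool → ℂ) :
    CubicLayer.run (chooseLayers n L) (registerState fun x c p =>
        if x = 0 ∧ p = 0 then ∏ q, amp q (c q) else 0) =
      registerState fun x c p => if p = onPath (fun q => x q.1) then
        ∏ q, (if p q then (if c q = false then amp q (x q.1) else 0) else amp q (c q)) else 0 := by
  rw [chooseLayers, CubicLayer.run_append, CubicLayer.run_append, run_pathSteps _ hL, run_bitStep,
    run_clearStep]
  congr 1
  funext x c p
  refine (if_congr (chosen_iff x (fun q => c q + p q * x q.1) p) rfl rfl).trans ?_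
  rw [ite_and, ← Fintype.prod_ite_zero]
  refine if_congr Iff.rfl (Finset.prod_congr rfl fun q _ => ?_) rfl
  rcases Bool.eq_false_or_eq_true (p q) with hp | hp <;>
    rcases Bool.eq_false_or_eq_true (c q) with hc | hc <;>
    rcases Bool.eq_false_or_eq_true (x q.1) with hx | hx <;>
    simp [hp, hc, hx, Bool.add_eq_xor, Bool.mul_eq_and]

theorem sum_untoss_mul_coinAmp (m j : ℕ) (p x c : Bool) :
    ∑ b, (((coinRotation m j * signGate : Matrix.unitaryGroup Bool ℂ) : Matrix Bool Bool ℂ) *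
        Matrix.diagonal (fun b => boolSign (b * p)) *
        ((coinRotation m j)⁻¹ : Matrix.unitaryGroup Bool ℂ)) c b *
        (if p then (if b = false then coinAmp m j x else 0) else coinAmp m j b) =
      if c = false then (if p then coinAmp m j x else 1) else 0 := by
  cases p
  · have diagonal_eq : Matrix.diagonal (fun b => boolSign (b * false)) = 1 := by
      simp only [← Bool.zero_eq_false, mul_zero, boolSign_zero, Matrix.diagonal_one]
    have coinGate_sq : (coinGate m j * coinGate m j : Matrix Bool Bool ℂ) = 1 :=
      congrArg Subtype.val (coinGate_mul_self m j)
    have := congrFun (congrFun coinGate_sq c) false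
    rw [Matrix.mul_apply, Matrix.one_apply] at this
    rw [diagonal_eq, mul_one]
    exact this
  · have cancel : coinRotation m j * signGate * signGate * (coinRotation m j)⁻¹ = 1 := by
      rw [mul_assoc (coinRotation m j), signGate_mul_self, mul_one, mul_inv_cancel]
    have diagonal_eq : Matrix.diagonal (fun b => boolSign (b * true)) = signGate := by
      simp only [← Bool.one_eq_true, mul_one]
      rfl
    rw [diagonal_eq]
    simp only [← Submonoid.coe_mul, cancel]
    simp [Matrix.one_apply]

theorem run_untossLayers {k : ℕ} (hk : k ≤ n) :
    CubicLayer.run (untossLayers n k L) (registerState fun x c p =>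
        if p = onPath (fun q => x q.1) then ∏ q : Fin n × Fin (n + 1),
          (if p q then (if c q = false then coinAmp (n - q.1) (k - q.2) (x q.1) else 0)
            else coinAmp (n - q.1) (k - q.2) (c q)) else 0) =
      registerState fun x c p =>
        if c = 0 ∧ p = onPath (fun q => x q.1) then dickeState n k x else 0 := by
  rw [untossLayers, run_controlStep_sandwich]
  congr 1
  funext x c p
  by_cases hp : p = onPath fun q => x q.1
  · simp only [if_pos hp]
    rw [localMap_prod _ fun q b => if p q then (if b = false then
      coinAmp (n - q.1) (k - q.2) (x q.1) else 0) else coinAmp (n - q.1) (k - q.2) b]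
    simp only [sum_untoss_mul_coinAmp, Fintype.prod_ite_zero, hp, prod_coinAmp_path hk]
    exact if_congr ((iff_of_eq (and_true _)).trans funext_iff).symm rfl rfl
  · simp [hp, localMap]

theorem run_uncomputeLayers (hL : n ≤ 2 ^ L) (ψ : QState (Fin n)) :
    CubicLayer.run (uncomputeLayers n L) (registerState fun x c p =>
        if c = 0 ∧ p = onPath (fun q => x q.1) then ψ x else 0) =
      registerState fun x c p => if c = 0 ∧ p = 0 then ψ x else 0 := by
  rw [uncomputeLayers, CubicLayer.run_append, CubicLayer.run_append, run_copyStep,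
    run_pathSteps _ hL, run_copyStep]
  congr 1
  funext x c p
  have cancel : (fun q => c q + x q.1 + x q.1) = c :=
    funext fun q => by rw [add_assoc, BooleanRing.add_self, add_zero]
  simp only [cancel]
  by_cases hc : c = 0 <;> simp [hc]

theorem run_dickeLayers (hL : n ≤ 2 ^ L) {k : ℕ} (hk : k ≤ n) :
    CubicLayer.run (dickeLayers n k L) (zeroState (DickeReg n L)) =
      withAncillas bitEmb (dickeState n k) := by
  rw [dickeLayers, ← List.singleton_append, CubicLayer.run_append, CubicLayer.run_append,
    CubicLayer.run_append, run_tossLayer, run_chooseLayers hL, run_untossLayers hk,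
    run_uncomputeLayers hL, withAncillas_bitEmb]

end DickeReg

/-! ### Resource bounds -/

/-- The number of doublings after which the segments of positions cover strings of length `n`. -/
def doublingDepth (n : ℕ) : ℕ := Nat.log 2 n + 1

theorem le_two_pow_doublingDepth (n : ℕ) : n ≤ 2 ^ doublingDepth n :=
  (Nat.lt_pow_succ_log_self one_lt_two n).le

theorem DickeReg.card_le (n : ℕ) :
    Fintype.card (DickeReg n (doublingDepth n)) ≤ 4 * (n + 1) ^ 4 := by
  have card_seg_le : (doublingDepth n + 1) * (n * ((n + 1) * (n + 1))) ≤ 2 * (n + 1) ^ 4 := by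
    have log_le : doublingDepth n + 1 ≤ 2 * (n + 1) := by
      have := Nat.log_le_self 2 n
      rw [doublingDepth]
      omega
    calc
      _ ≤ 2 * (n + 1) * ((n + 1) * ((n + 1) * (n + 1))) := by gcongr; omega
      _ = 2 * (n + 1) ^ 4 := by ring
  have card_bit_coin_pos_le : n + 2 * (n * (n + 1)) ≤ 2 * (n + 1) ^ 4 := by
    calc
      _ ≤ 2 * (n + 1) ^ 2 := by nlinarith
      _ ≤ 2 * (n + 1) ^ 4 := by gcongr <;> omega
  rw [DickeReg.card_eq]
  linarith

/-- A number of qubits which suffices for strings of length `n`. -/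
def qubitBound (n : ℕ) : ℕ := 12288 * (n + 1) ^ 16

theorem DickeReg.qubits_le (n : ℕ) :
    48 * Fintype.card (DickeReg n (doublingDepth n)) ^ 4 ≤ qubitBound n :=
  calc
    _ ≤ 48 * (4 * (n + 1) ^ 4) ^ 4 := by gcongr; exact DickeReg.card_le n
    _ = qubitBound n := by rw [qubitBound]; ring

theorem clog_qubitBound_le (n : ℕ) : Nat.clog 2 (qubitBound n) ≤ 16 * Nat.log 2 n + 30 := by
  apply Nat.clog_le_of_le_pow
  calc
    12288 * (n + 1) ^ 16 ≤ 2 ^ 14 * (2 ^ (Nat.log 2 n + 1)) ^ 16 := by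
      gcongr
      · norm_num
      · exact Nat.lt_pow_succ_log_self one_lt_two n
    _ = 2 ^ (16 * Nat.log 2 n + 30) := by
      rw [← pow_mul, ← pow_add]
      congr 1
      ring

theorem natLog_mul_log_le {m : ℕ} (hm : m ≠ 0) : Nat.log 2 m * Real.log 2 ≤ Real.log m := by
  rw [← Real.log_pow]
  exact Real.log_le_log (by positivity) (by exact_mod_cast Nat.pow_log_le_self 2 hm)

theorem isBigO_log_affine (a b : ℕ) :
    (fun m : ℕ => ((a * Nat.log 2 m + b : ℕ) : ℝ)) =O[Filter.atTop]
      fun m : ℕ => Real.log m := by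
  have log_two_pos : 0 < Real.log 2 := Real.log_pos one_lt_two
  refine Asymptotics.IsBigO.of_bound ((a + b : ℕ) / Real.log 2) ?_
  filter_upwards [Filter.eventually_ge_atTop 2] with m hm
  have log_two_le : Real.log 2 ≤ Real.log m :=
    Real.log_le_log two_pos (by exact_mod_cast hm)
  rw [Real.norm_of_nonneg (Nat.cast_nonneg _),
    Real.norm_of_nonneg (log_two_pos.le.trans log_two_le), div_mul_eq_mul_div,
    le_div_iff₀ log_two_pos]
  push_cast
  calc
    (a * Nat.log 2 m + b) * Real.log 2 = a * (Nat.log 2 m * Real.log 2) + b * Real.log 2 := by ring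
    _ ≤ a * Real.log m + b * Real.log m := by
      gcongr
      exact natLog_mul_log_le (by omega)
    _ = (a + b) * Real.log m := by ring

theorem exists_dickeCircuit {n k : ℕ} (hn : 1 ≤ n) (hk : k ≤ n) :
    ∃ C : LAQCircuit, C.numQubits ≤ qubitBound n ∧
      C.alternations.length ≤ 24 * Nat.log 2 n + 93 ∧
      (∀ A ∈ C.alternations, A.quantum.length ≤ 10 ∧
        A.conventional.depth ≤ 48 * Nat.log 2 n + 91 ∧
        A.conventional.size ≤ 12 * qubitBound n ^ 2) ∧
      Prepares C.alternations (dickeState n k) := by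
  have qubits_le := DickeReg.qubits_le n
  have : Nonempty (DickeReg n (doublingDepth n)) := ⟨.bit ⟨0, hn⟩⟩
  obtain ⟨C, hC, hlen, hA, hprep⟩ :=
    exists_laqCircuit (DickeReg n (doublingDepth n)) (DickeReg.dickeLayers n k (doublingDepth n))
  refine ⟨C, hC.trans_le qubits_le, ?_, fun A h => ⟨(hA A h).1, ?_, ?_⟩, hprep _ _
    (DickeReg.run_dickeLayers (le_two_pow_doublingDepth n) hk)⟩
  · rw [hlen, DickeReg.length_dickeLayers, doublingDepth]
    omega
  · have depth_le := (hA A h).2.1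
    have clog_le := (Nat.clog_mono_right 2 qubits_le).trans (clog_qubitBound_le n)
    omega
  · refine (hA A h).2.2.trans ?_
    gcongr

theorem theorem7p5p1 :
    ∃ C : {p : ℕ × ℕ // 1 ≤ p.2 ∧ p.2 ≤ p.1} → LAQCircuit,
      IsLAQCCLOG (fun i => i.1.1) C ∧
      (∃ q : Polynomial ℕ, ∀ i, (C i).numQubits ≤ q.eval i.1.1) ∧
      ∀ i, Prepares (C i).alternations (dickeState i.1.1 i.1.2) := by
  choose C hqubits hlen hA hprep using
    fun i : {p : ℕ × ℕ // 1 ≤ p.2 ∧ p.2 ≤ p.1} =>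
      exists_dickeCircuit (i.2.1.trans i.2.2) i.2.2
  let q : Polynomial ℕ := 12288 * (Polynomial.X + 1) ^ 16
  have q_eval (n : ℕ) : q.eval n = qubitBound n := by simp [q, qubitBound]
  refine ⟨C, ⟨⟨10, fun i A h => (hA i A h).1⟩, ⟨fun n => 48 * Nat.log 2 n + 91, 12 * q ^ 2,
    isBigO_log_affine 48 91, fun i A h => ⟨(hA i A h).2.1, ?_⟩⟩,
    ⟨fun n => 24 * Nat.log 2 n + 93, isBigO_log_affine 24 93, hlen⟩⟩,
    ⟨q, fun i => (hqubits i).trans_eq (q_eval _).symm⟩, hprep⟩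
  refine (hA i A h).2.2.trans_eq ?_
  rw [← q_eval]
  simp
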